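/- Let $(\Omega,\mathcal F,\mathbb P)$ be a nonatomic probability space, let $p\in[1,\infty]$, and let $L^p=L^p(\Omega,\mathcal F,\mathbb P)$, whose elements (identified when almost surely equal) are interpreted as random losses; real constants are regarded as elements of $L^p$. A law-invariant deviation measure on $L^p$ is a functional $D:L^p\to[0,\infty)$ such that for all $X,Y\in L^p$: $D(X+c)=D(X)$ for all $c\in\mathbb R$; $D(X)>0$ if $X$ is nonconstant; $D(\lambda X)=\lambda D(X)$ for all $\lambda\ge 0$; $D(X+Y)\le D(X)+D(Y)$; and $D(X)=D(Y)$ whenever $X$ and $Y$ have the same distribution. It is called range normalized if $$\sup\left\{\frac{D(X)}{\operatorname{ess\,sup}X-\mathbb E[X]}: X\in L^p \text{ nonconstant}\right\}=1,$$ where the quotient is $0$ if $\operatorname{ess\,sup}X=\infty$. A risk-weighting function is a nonconstant, increasing (not necessarily strictly), $1$-Lipschitz function $g:[0,\infty)\to\mathbb R$ with $g(0)=0$. For $X,Y\in L^p$ write $X\le_{\rm cx}Y$ if $\mathbb E[X]=\mathbb E[Y]$ and $\mathbb E[u(X)]\le\mathbb E[u(Y)]$ for all increasing convex $u:\mathbb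 R\to\mathbb R$ (expectations taking values in $(-\infty,\infty]$). Let $\succeq$ be a preference relation on $L^p$, that is, a reflexive, transitive and complete binary relation, with strict part $\succ$ and symmetric part $\simeq$. Consider the following axioms, for all $X,Y\in L^p$. - A1 (Monotonicity). If $X\le Y$ almost surely, then $X\succeq Y$. - A2 (Translation invariance). For every $c\in\mathbb R$, $X\succeq Y$ if and only if $X+c\succeq Y+c$. - A3 (Weak positive homogeneity). If $\mathbb E[X]=\mathbb E[Y]$ and $X\succeq Y$, then $\lambda X\succeq\lambda Y$ for every $\lambda>0$. - A4 (Risk aversion). If $X\le_{\rm cx}Y$, then $X\succeq Y$. In addition, $\mathbb E[X]\succ X$ if $X$ is nonconstant. - A5 (Solvability). There exists $c\in\mathbb R$ such that $X\simeq c$. - A6 (Weak convexity). If $\mathbb E[X]=\mathbb E[Y]$ and $X\simeq Y$, then $\lambda X+(1-\lambda)Y\succeq X$ for every $\lambda\in[0,1]$. - A7 (Continuity). The sets $\{Z\in L^p:Z\succeq X\}$ and $\{Z\in L^p:X\succeq Z\}$ are closed in the $L^p$-norm. Theorem. The relation $\succeq$ satisfies Axioms A1–A7 if and only if there exist a range-normalized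 law-invariant deviation measure $D$ on $L^p$ and a strictly increasing risk-weighting function $g$ such that $\succeq$ is represented by $\mathrm{MD}^D_g=g\circ D+\mathbb E$, that is, for all $X,Y\in L^p$, $$X\succeq Y\iff g(D(X))+\mathbb E[X]\le g(D(Y))+\mathbb E[Y].$$ -/

import Mathlib

open MeasureTheory ProbabilityTheory
open scoped ENNReal NNReal

noncomputable section

namespace MeanDeviation

/-- A measure is nonatomic if every measurable set of positive measure contains a measurable
subset of strictly smaller positive measure. (Being null on singletons is a weaker property on a
general measurable space.) -/
def Nonatomic {Ω : Type*} [MeasurableSpace Ω] (μ : Measure Ω) : Prop :=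
  ∀ A : Set Ω, MeasurableSet A → 0 < μ A →
    ∃ B : Set Ω, MeasurableSet B ∧ B ⊆ A ∧ 0 < μ B ∧ μ B < μ A

section Deviation

variable {Ω : Type*} [MeasurableSpace Ω] {p : ℝ≥0∞} {μ : Measure Ω} [IsProbabilityMeasure μ]

/-- The random variable `X` is (almost surely) not constant. -/
def Nonconst (X : Lp ℝ p μ) : Prop :=
  ¬ ∃ c : ℝ, X = Lp.const p μ c

/-- Law-invariant deviation measures `D : L^p → [0, ∞)`. -/
structure IsDeviation (D : Lp ℝ p μ → ℝ≥0) : Prop where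
  translation : ∀ (X : Lp ℝ p μ) (c : ℝ), D (X + Lp.const p μ c) = D X
  pos : ∀ X : Lp ℝ p μ, Nonconst X → 0 < D X
  posHom : ∀ (X : Lp ℝ p μ) (t : ℝ≥0), D ((t : ℝ) • X) = t * D X
  subadd : ∀ X Y : Lp ℝ p μ, D (X + Y) ≤ D X + D Y
  lawInv : ∀ X Y : Lp ℝ p μ, IdentDistrib X Y μ μ → D X = D Y

/-- The quotient `D(X) / (ess-sup X - E[X])`, as an extended real number. The essential supremum
is taken in the extended reals; where it is `+∞` the quotient is `0`. -/
def rangeRatio (D : Lp ℝ p μ → ℝ≥0) (X : Lp ℝ p μ) : EReal :=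
  (((D X : ℝ≥0) : ℝ) : EReal) /
    (essSup (fun ω => ((X ω : ℝ) : EReal)) μ - ((∫ ω, X ω ∂μ : ℝ) : EReal))

/-- Range-normalized law-invariant deviation measures. -/
structure IsRangeNormalized (D : Lp ℝ p μ → ℝ≥0) : Prop where
  isDeviation : IsDeviation D
  sup_eq_one : sSup (rangeRatio D '' {X : Lp ℝ p μ | Nonconst X}) = 1

/-- Risk-weighting functions: non-constant, increasing (in the non-strict sense), `1`-Lipschitz
functions `g : [0, ∞) → ℝ` with `g 0 = 0`. -/
structure IsRiskWeighting (g : ℝ≥0 → ℝ) : Prop where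
  nonconst : ∃ x y : ℝ≥0, g x ≠ g y
  mono : Monotone g
  lipschitz : LipschitzWith 1 g
  zero : g 0 = 0

/-- The functional `MD^D_g = g ∘ D + E`. -/
def MD (g : ℝ≥0 → ℝ) (D : Lp ℝ p μ → ℝ≥0) (X : Lp ℝ p μ) : ℝ :=
  g (D X) + ∫ ω, X ω ∂μ

end Deviation

section Preference

variable {Ω : Type*} [MeasurableSpace Ω] {p : ℝ≥0∞} {μ : Measure Ω}

/-- Preference relations: total preorders. -/
structure IsPreference {α : Type*} (R : α → α → Prop) : Prop where
  refl : ∀ x, R x x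
  trans : ∀ x y z, R x y → R y z → R x z
  total : ∀ x y, R x y ∨ R y x

/-- The strict part of a relation. -/
def StrictPart {α : Type*} (R : α → α → Prop) (x y : α) : Prop := R x y ∧ ¬ R y x

/-- The symmetric part (indifference) of a relation. -/
def Indiff {α : Type*} (R : α → α → Prop) (x y : α) : Prop := R x y ∧ R y x

/-- `ρ` (a risk functional, smaller is better) represents the relation `R`. -/
def Represents {α : Type*} (ρ : α → ℝ) (R : α → α → Prop) : Prop :=
  ∀ x y, R x y ↔ ρ x ≤ ρ y

/-- Second-order stochastic dominance for losses: `E[u(X)] ≤ E[u(Y)]` for all increasing convex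
`u : ℝ → ℝ`. For integrable `X` and convex `u`, the expectation `E[u(X)]` always exists in
`(-∞, +∞]`, and it equals `+∞` exactly when `u(X)` is not integrable; the inequality between
these extended real numbers is what is spelled out here. -/
def SSD (X Y : Lp ℝ p μ) : Prop :=
  ∀ u : ℝ → ℝ, Monotone u → ConvexOn ℝ Set.univ u →
    Integrable (fun ω => u (Y ω)) μ →
      Integrable (fun ω => u (X ω)) μ ∧ ∫ ω, u (X ω) ∂μ ≤ ∫ ω, u (Y ω) ∂μ

/-- Convex order: second-order stochastic dominance with equal means. -/
def ConvexOrder (X Y : Lp ℝ p μ) : Prop :=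
  SSD X Y ∧ ∫ ω, X ω ∂μ = ∫ ω, Y ω ∂μ

/-- The axioms on a relation `R` on `L^p`, where `R X Y` reads "`X` is preferred over `Y`" and
elements of `L^p` are losses. -/
structure Axioms [Fact (1 ≤ p)] [IsProbabilityMeasure μ]
    (R : Lp ℝ p μ → Lp ℝ p μ → Prop) : Prop where
  /-- Monotonicity. -/
  A1 : ∀ X Y : Lp ℝ p μ, X ≤ Y → R X Y
  /-- Translation invariance. -/
  A2 : ∀ (X Y : Lp ℝ p μ) (c : ℝ), R X Y ↔ R (X + Lp.const p μ c) (Y + Lp.const p μ c)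
  /-- Weak positive homogeneity. -/
  A3 : ∀ X Y : Lp ℝ p μ, ∫ ω, X ω ∂μ = ∫ ω, Y ω ∂μ → R X Y →
    ∀ t : ℝ, 0 < t → R (t • X) (t • Y)
  /-- Risk aversion, first part. -/
  A4_convexOrder : ∀ X Y : Lp ℝ p μ, ConvexOrder X Y → R X Y
  /-- Risk aversion, second part. -/
  A4_strict : ∀ X : Lp ℝ p μ, Nonconst X → StrictPart R (Lp.const p μ (∫ ω, X ω ∂μ)) X
  /-- Solvability. -/
  A5 : ∀ X : Lp ℝ p μ, ∃ c : ℝ, Indiff R X (Lp.const p μ c)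
  /-- Weak convexity. -/
  A6 : ∀ X Y : Lp ℝ p μ, ∫ ω, X ω ∂μ = ∫ ω, Y ω ∂μ → Indiff R X Y →
    ∀ t : ℝ, 0 ≤ t → t ≤ 1 → R (t • X + (1 - t) • Y) X
  /-- Continuity: upper and lower contour sets are closed in the `L^p` norm. -/
  A7 : ∀ X : Lp ℝ p μ, IsClosed {Y : Lp ℝ p μ | R Y X} ∧ IsClosed {Y : Lp ℝ p μ | R X Y}

end Preference

end MeanDeviation

end

/-!
A mean-deviation functional `g ∘ D + E` compares losses of equal mean through `D` alone, and the
two directions are of different depth.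

*From `D` and `g` to the axioms.* By range normalization `D X ≤ ess-sup X - E[X]`, so `D + E` is
monotone: it is a law-invariant coherent risk measure (`IsCoherentRisk`). A monotone sublinear
functional on `L^p` is bounded on the unit ball, hence Lipschitz (`IsCoherentRisk.exists_bound`).
Monotonicity passes from `D + E` to `g ∘ D + E` because `g` is 1-Lipschitz. The remaining point is
consistency with the convex order, `IsCoherentRisk.le_of_SSD`, and it is proved for all `p`,
including `p = ∞`, without duality:

* on a nonatomic space a two-valued piece of a simple loss has equidistributed copies whose mean is
  uniformly close to its average (`Nonatomic.exists_balanced`), so averaging two cells of a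
  partition, or transferring mass from a cell with a larger value to one with a smaller value, does
  not increase the risk (`IsSimpleRisk.transfer_le`);
* finitely many such transfers and decreases of values turn a step function into any increasing
  one on the same ordered partition whose tail sums it dominates (`IsSimpleRisk.le_of_tail_sums`, a
  weighted form of the Hardy–Littlewood–Pólya theorem);
* after a comonotone coupling (`Nonatomic.exists_comonotone`), stop-loss inequalities
  `E[(X - t)⁺] ≤ E[(Y - t)⁺]` between simple losses are such tail inequalities, and general losses
  are approximated in norm by simple ones for which the stop-loss inequalities still hold.

*From the axioms to `D` and `g`.* Let `ρ X` be the sure loss indifferent to `X`. On centered losses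
weak homogeneity and continuity make `t ↦ ρ (t X₀)` strictly increasing for a fixed nonconstant
`X₀`, and every centered loss is equivalent to exactly one `t X₀`, `t ≥ 0`; this `t`, for
`X - E[X]`, is the deviation `D X`. Weak convexity makes it subadditive. So `ρ X` is a strictly
increasing function of `D X`, plus `E[X]`. Monotonicity bounds `D` on centered losses below `1`;
dividing by the least such bound normalizes `D`, and testing monotonicity on a nearly optimal `Z`,
through `t Z ≤ s Z + (t - s)`, shows that the weight function is 1-Lipschitz
(`IsRayDeviation.ray_sub_le`).
-/

noncomputable section

namespace MeanDeviation

/-! ### Sets of prescribed measure in a nonatomic space -/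

section Nonatomic

variable {Ω : Type*} [MeasurableSpace Ω] {μ : Measure Ω} [IsFiniteMeasure μ]

/-- In a nonatomic space a set of positive measure has subsets of arbitrarily small positive
measure: keep the smaller half of a nontrivial splitting. -/
lemma Nonatomic.exists_subset_pos_le (hμ : Nonatomic μ) {A : Set Ω} (hA : MeasurableSet A)
    (hpos : 0 < μ.real A) {ε : ℝ} (hε : 0 < ε) :
    ∃ B, MeasurableSet B ∧ B ⊆ A ∧ 0 < μ.real B ∧ μ.real B ≤ ε := by
  have half : ∀ n : ℕ, ∃ B, MeasurableSet B ∧ B ⊆ A ∧ 0 < μ.real B ∧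
      μ.real B ≤ μ.real A * (1 / 2) ^ n := by
    intro n
    induction n with
    | zero => exact ⟨A, hA, subset_rfl, hpos, by simp⟩
    | succ n ih =>
      obtain ⟨B, hB, hBA, hB0, hBn⟩ := ih
      obtain ⟨C, hC, hCB, hC0, hClt⟩ :=
        hμ B hB (ENNReal.toReal_pos_iff.1 hB0).1
      have hC0' : 0 < μ.real C := ENNReal.toReal_pos hC0.ne' (measure_ne_top μ C)
      have hClt' : μ.real C < μ.real B :=
        (ENNReal.toReal_lt_toReal (measure_ne_top _ _) (measure_ne_top _ _)).2 hClt
      have hdiff : μ.real (B \ C) = μ.real B - μ.real C := measureReal_sdiff hCB hC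
      rw [pow_succ]
      by_cases h : μ.real C ≤ μ.real B / 2
      · exact ⟨C, hC, hCB.trans hBA, hC0', by linarith⟩
      · exact ⟨B \ C, hB.diff hC, Set.sdiff_subset.trans hBA, by linarith, by linarith⟩
  obtain ⟨n, hn⟩ := exists_pow_lt_of_lt_one (div_pos hε hpos) (by norm_num : (1 / 2 : ℝ) < 1)
  obtain ⟨B, hB, hBA, hB0, hBn⟩ := half n
  refine ⟨B, hB, hBA, hB0, hBn.trans ?_⟩
  rw [lt_div_iff₀ hpos] at hn
  linarith

/-- Sierpiński's theorem: a finite nonatomic measure takes on the subsets of `A` all values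
between `0` and the measure of `A`. The subset is built greedily, adding at each step a piece of
at least half the largest measure that still fits. -/
lemma Nonatomic.exists_subset_measureReal_eq (hμ : Nonatomic μ) {A : Set Ω}
    (hA : MeasurableSet A) {t : ℝ} (ht0 : 0 ≤ t) (htA : t ≤ μ.real A) :
    ∃ B, MeasurableSet B ∧ B ⊆ A ∧ μ.real B = t := by
  let fits : Set Ω → Set ℝ := fun B =>
    {r | ∃ C, MeasurableSet C ∧ C ⊆ A \ B ∧ μ.real C ≤ t - μ.real B ∧ μ.real C = r}
  let P : Set Ω → Prop := fun B => MeasurableSet B ∧ B ⊆ A ∧ μ.real B ≤ t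
  have hbdd : ∀ B, BddAbove (fits B) := fun B =>
    ⟨t - μ.real B, by rintro _ ⟨C, -, -, h, rfl⟩; exact h⟩
  have step : ∀ B, P B → ∃ C, MeasurableSet C ∧ C ⊆ A \ B ∧ μ.real C ≤ t - μ.real B ∧
      sSup (fits B) / 2 ≤ μ.real C := by
    intro B hB
    have hne : (fits B).Nonempty := ⟨0, ∅, .empty, by simp, by simpa using hB.2.2, by simp⟩
    by_cases h0 : sSup (fits B) ≤ 0
    · exact ⟨∅, .empty, by simp, by simpa using hB.2.2, by simp; linarith⟩
    · push Not at h0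
      obtain ⟨_, ⟨C, hC, hCA, hCt, rfl⟩, hlt⟩ := exists_lt_of_lt_csSup hne (half_lt_self h0)
      exact ⟨C, hC, hCA, hCt, hlt.le⟩
  choose! next hnext using step
  let B : ℕ → Set Ω := fun n => Nat.rec ∅ (fun _ s => s ∪ next s) n
  have hBsucc : ∀ n, B (n + 1) = B n ∪ next (B n) := fun n => rfl
  have hadd : ∀ n, P (B n) → μ.real (B (n + 1)) = μ.real (B n) + μ.real (next (B n)) := by
    intro n h
    obtain ⟨hC, hCA, -, -⟩ := hnext _ h
    rw [hBsucc]
    exact measureReal_union (Set.disjoint_left.2 fun x hx hx' => (hCA hx').2 hx) hC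
  have hP : ∀ n, P (B n) := by
    intro n
    induction n with
    | zero => exact ⟨.empty, by simp [B], by simpa [B] using ht0⟩
    | succ n ih =>
      obtain ⟨hC, hCA, hCt, -⟩ := hnext _ ih
      refine ⟨ih.1.union hC, Set.union_subset ih.2.1 (hCA.trans Set.sdiff_subset), ?_⟩
      rw [hadd n ih]
      linarith
  have hmono : Monotone B := monotone_nat_of_le_succ fun n => Set.subset_union_left
  have hUm : MeasurableSet (⋃ n, B n) := .iUnion fun n => (hP n).1
  have hUA : (⋃ n, B n) ⊆ A := Set.iUnion_subset fun n => (hP n).2.1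
  have hlim : Filter.Tendsto (fun n => μ.real (B n)) Filter.atTop
      (nhds (μ.real (⋃ n, B n))) :=
    (ENNReal.tendsto_toReal (measure_ne_top _ _)).comp (tendsto_measure_iUnion_atTop hmono)
  have hUt : μ.real (⋃ n, B n) ≤ t := le_of_tendsto' hlim fun n => (hP n).2.2
  refine ⟨⋃ n, B n, hUm, hUA, hUt.antisymm ?_⟩
  by_contra! hlt
  have hdiff : μ.real (A \ ⋃ n, B n) = μ.real A - μ.real (⋃ n, B n) :=
    measureReal_sdiff hUA hUm
  obtain ⟨C, hC, hCA, hC0, hCt⟩ := hμ.exists_subset_pos_le (hA.diff hUm)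
    (by rw [hdiff]; linarith) (sub_pos.2 hlt)
  -- `C` fits at every stage, so every step adds at least half its measure.
  have hgrow : ∀ n, μ.real C / 2 ≤ μ.real (B (n + 1)) - μ.real (B n) := by
    intro n
    have h1 : μ.real (B n) ≤ μ.real (⋃ n, B n) := measureReal_mono (Set.subset_iUnion B n)
    have h2 : μ.real C ≤ sSup (fits (B n)) := le_csSup (hbdd _)
      ⟨C, hC, hCA.trans (Set.sdiff_subset_sdiff_right (Set.subset_iUnion B n)), by linarith, rfl⟩
    have h3 := (hnext _ (hP n)).2.2.2
    rw [hadd n (hP n)]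
    linarith
  have h0 : Filter.Tendsto (fun n => μ.real (B (n + 1)) - μ.real (B n)) Filter.atTop
      (nhds 0) := by
    simpa using ((Filter.tendsto_add_atTop_iff_nat 1).2 hlim).sub hlim
  have := ge_of_tendsto' h0 hgrow
  linarith

/-- Balanced covering: there are `N` subsets of `C` of measure `q` such that any two points of `C`
are covered almost equally often. Each new subset takes first the points covered less often. -/
lemma Nonatomic.exists_balanced (hμ : Nonatomic μ) {C : Set Ω} (hC : MeasurableSet C) {q : ℝ}
    (hq0 : 0 ≤ q) (hqC : q ≤ μ.real C) (N : ℕ) :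
    ∃ G : ℕ → Set Ω, (∀ k, MeasurableSet (G k) ∧ G k ⊆ C ∧ μ.real (G k) = q) ∧
      ∃ m : ℝ, ∀ ω ∈ C, ∑ k ∈ Finset.range N, (G k).indicator (fun _ => (1 : ℝ)) ω = m ∨
        ∑ k ∈ Finset.range N, (G k).indicator (fun _ => (1 : ℝ)) ω = m + 1 := by
  induction N with
  | zero =>
    obtain ⟨G, hG, hGC, hGq⟩ := hμ.exists_subset_measureReal_eq hC hq0 hqC
    exact ⟨fun _ => G, fun _ => ⟨hG, hGC, hGq⟩, 0, by simp⟩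
  | succ N ih =>
    obtain ⟨G, hG, m, hm⟩ := ih
    let S : Ω → ℝ := fun ω => ∑ k ∈ Finset.range N, (G k).indicator (fun _ => (1 : ℝ)) ω
    have hS : Measurable S :=
      Finset.measurable_fun_sum _ fun k _ => measurable_const.indicator (hG k).1
    let H := C ∩ S ⁻¹' {m}
    have hH : MeasurableSet H := hC.inter (hS (measurableSet_singleton m))
    have hnew : ∀ G' : Set Ω, MeasurableSet G' → G' ⊆ C → μ.real G' = q →
        (∃ m' : ℝ, ∀ ω ∈ C, S ω + G'.indicator (fun _ => (1 : ℝ)) ω = m' ∨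
          S ω + G'.indicator (fun _ => (1 : ℝ)) ω = m' + 1) →
        ∃ G : ℕ → Set Ω, (∀ k, MeasurableSet (G k) ∧ G k ⊆ C ∧ μ.real (G k) = q) ∧
          ∃ m : ℝ, ∀ ω ∈ C,
            ∑ k ∈ Finset.range (N + 1), (G k).indicator (fun _ => (1 : ℝ)) ω = m ∨
            ∑ k ∈ Finset.range (N + 1), (G k).indicator (fun _ => (1 : ℝ)) ω = m + 1 := by
      rintro G' h1 h2 h3 ⟨m', hm'⟩
      refine ⟨Function.update G N G', fun k => ?_, m', fun ω hω => ?_⟩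
      · by_cases hk : k = N
        · subst hk; simpa using ⟨h1, h2, h3⟩
        · simpa [hk] using hG k
      · have : ∑ k ∈ Finset.range (N + 1),
            (Function.update G N G' k).indicator (fun _ => (1 : ℝ)) ω =
            S ω + G'.indicator (fun _ => (1 : ℝ)) ω := by
          rw [Finset.sum_range_succ, Function.update_self]
          congr 1
          refine Finset.sum_congr rfl fun k hk => ?_
          rw [Function.update_of_ne (Finset.mem_range.1 hk).ne]
        rw [this]
        exact hm' ω hω
    by_cases h : q ≤ μ.real H
    · obtain ⟨G', h1, h2, h3⟩ := hμ.exists_subset_measureReal_eq hH hq0 h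
      refine hnew G' h1 (h2.trans Set.inter_subset_left) h3 ⟨m, fun ω hω => ?_⟩
      by_cases hG' : ω ∈ G'
      · have : S ω = m := (h2 hG').2
        simp [hG', this]
      · simpa [hG'] using hm ω hω
    · push Not at h
      have hdiff : μ.real (C \ H) = μ.real C - μ.real H :=
        measureReal_sdiff Set.inter_subset_left hH
      obtain ⟨G', h1, h2, h3⟩ := hμ.exists_subset_measureReal_eq (hC.diff hH)
        (sub_nonneg.2 h.le) (by linarith : q - μ.real H ≤ μ.real (C \ H))
      refine hnew (H ∪ G') (hH.union h1)
        (Set.union_subset Set.inter_subset_left (h2.trans Set.sdiff_subset)) ?_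
        ⟨m + 1, fun ω hω => ?_⟩
      · rw [measureReal_union (Set.disjoint_left.2 fun x hx hx' => (h2 hx').2 hx) h1, h3]
        ring
      · by_cases hωH : ω ∈ H
        · have : S ω = m := hωH.2
          simp [hωH, this]
        · have hSω : S ω = m + 1 := (hm ω hω).resolve_left fun h => hωH ⟨hω, h⟩
          by_cases hG' : ω ∈ G' <;> simp [hωH, hG', hSω]

end Nonatomic

/-! ### Averaging and transfers between cells -/

section SimpleRisk

variable {Ω : Type*} [MeasurableSpace Ω] {μ : Measure Ω}

/-- A monotone, translation-invariant, sublinear and law-invariant functional on simple random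
losses: a law-invariant coherent risk measure restricted to simple functions. -/
structure IsSimpleRisk (μ : Measure Ω) (F : SimpleFunc Ω ℝ → ℝ) : Prop where
  mono : ∀ f g : SimpleFunc Ω ℝ, (∀ ω, f ω ≤ g ω) → F f ≤ F g
  translation : ∀ (f : SimpleFunc Ω ℝ) (c : ℝ), F (f + SimpleFunc.const Ω c) = F f + c
  posHom : ∀ (f : SimpleFunc Ω ℝ) (t : ℝ), 0 ≤ t → F (t • f) = t * F f
  subadd : ∀ f g : SimpleFunc Ω ℝ, F (f + g) ≤ F f + F g
  lawInv : ∀ f g : SimpleFunc Ω ℝ, μ.map f = μ.map g → F f = F g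

variable {F : SimpleFunc Ω ℝ → ℝ}

lemma IsSimpleRisk.sum_le (hF : IsSimpleRisk μ F) {f : SimpleFunc Ω ℝ} {Y : ℕ → SimpleFunc Ω ℝ}
    (hY : ∀ k, F (Y k) = F f) (N : ℕ) : F (∑ k ∈ Finset.range N, Y k) ≤ N * F f := by
  induction N with
  | zero => simpa using (hF.posHom 0 0 le_rfl).le
  | succ N ih =>
    rw [Finset.sum_range_succ]
    have := hF.subadd (∑ k ∈ Finset.range N, Y k) (Y N)
    rw [hY] at this
    push_cast
    linarith

variable [IsFiniteMeasure μ]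

/-- The law on `C` of a function with value `a` on `G ⊆ C` and `b` on the rest of `C`. -/
lemma measureReal_inter_preimage_of_two_values {f : Ω → ℝ} {C G B : Set Ω} {a b : ℝ}
    {T : Set ℝ} (hGm : MeasurableSet G) (hGC : G ⊆ C) (hfa : ∀ ω ∈ G, f ω = a)
    (hfb : ∀ ω ∈ C \ G, f ω = b) (hB : B = f ⁻¹' T) :
    μ.real (C ∩ B) = T.indicator (fun _ => μ.real G) a +
      T.indicator (fun _ => μ.real C - μ.real G) b := by
  classical
  subst hB
  have hdiff : μ.real (C \ G) = μ.real C - μ.real G := measureReal_sdiff hGC hGm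
  have split : C ∩ f ⁻¹' T = (G ∩ f ⁻¹' T) ∪ ((C \ G) ∩ f ⁻¹' T) := by
    rw [← Set.union_inter_distrib_right, Set.union_sdiff_cancel hGC]
  have h1 : G ∩ f ⁻¹' T = if a ∈ T then G else ∅ := by
    ext ω
    by_cases h : ω ∈ G
    · by_cases ha : a ∈ T <;> simp [h, hfa ω h, ha]
    · by_cases ha : a ∈ T <;> simp [h, ha]
  have h2 : (C \ G) ∩ f ⁻¹' T = if b ∈ T then C \ G else ∅ := by
    ext ω
    by_cases h : ω ∈ C \ G
    · by_cases hb : b ∈ T <;> simp [h.1, h.2, hfb ω h, hb]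
    · by_cases hb : b ∈ T
      · simp only [Set.mem_inter_iff, h, hb, if_true, false_and]
      · simp only [Set.mem_inter_iff, h, hb, if_false, false_and, Set.mem_empty_iff_false]
  rw [split, h1, h2]
  by_cases ha : a ∈ T <;> by_cases hb : b ∈ T <;> simp [ha, hb, hdiff, Set.union_sdiff_cancel hGC]

/-- Averaging a two-valued piece of a random loss does not increase the risk: the average is a
uniform limit of means of equidistributed copies, in which the set carrying the value `a` runs
through a balanced family. -/
lemma IsSimpleRisk.average_le (hF : IsSimpleRisk μ F) (hμ : Nonatomic μ) {f h : SimpleFunc Ω ℝ}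
    {C G : Set Ω} {a b : ℝ} (hC : MeasurableSet C) (hG : MeasurableSet G) (hGC : G ⊆ C)
    (hC0 : 0 < μ.real C) (hfa : ∀ ω ∈ G, f ω = a) (hfb : ∀ ω ∈ C \ G, f ω = b)
    (hout : ∀ ω ∉ C, h ω = f ω)
    (hin : ∀ ω ∈ C, h ω = b + (a - b) * (μ.real G / μ.real C)) : F h ≤ F f := by
  classical
  have key : ∀ N : ℕ, F h ≤ F f + |a - b| * (1 / ((N : ℝ) + 1)) := by
    intro n
    obtain ⟨N, hN⟩ : ∃ N, N = n + 1 := ⟨_, rfl⟩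
    have hN0 : (0 : ℝ) < N := by rw [hN]; positivity
    have hNn : ((n : ℝ) + 1) = N := by rw [hN]; push_cast; rfl
    rw [hNn]
    obtain ⟨H, hH, m, hm⟩ :=
      hμ.exists_balanced hC measureReal_nonneg (measureReal_mono hGC : μ.real G ≤ μ.real C) N
    let Y : ℕ → SimpleFunc Ω ℝ := fun k => SimpleFunc.piecewise C hC
      (SimpleFunc.piecewise (H k) (hH k).1 (.const Ω a) (.const Ω b)) f
    have hYC : ∀ k, ∀ ω ∈ C, Y k ω = b + (a - b) * (H k).indicator (fun _ => (1 : ℝ)) ω := by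
      intro k ω hω
      by_cases hk : ω ∈ H k <;> simp [Y, hω, hk]
    have hYout : ∀ k, ∀ ω ∉ C, Y k ω = f ω := by
      intro k ω hω
      simp [Y, hω]
    have hlaw : ∀ k, F (Y k) = F f := by
      intro k
      apply hF.lawInv
      ext T hT
      rw [Measure.map_apply (Y k).measurable hT, Measure.map_apply f.measurable hT,
        ← measureReal_eq_measureReal_iff, ← measureReal_inter_add_sdiff (s := Y k ⁻¹' T) hC,
        ← measureReal_inter_add_sdiff (s := f ⁻¹' T) hC,
        Set.inter_comm _ C, Set.inter_comm _ C]
      congr 1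
      · rw [measureReal_inter_preimage_of_two_values hG hGC hfa hfb rfl,
          measureReal_inter_preimage_of_two_values (hH k).1 (hH k).2.1 (a := a) (b := b)
            (fun ω hω => ?_) (fun ω hω => ?_) rfl, (hH k).2.2]
        · rw [hYC k ω ((hH k).2.1 hω)]; simp [hω]
        · rw [hYC k ω hω.1]; simp [hω.2]
      · congr 1
        ext ω
        simp only [Set.mem_sdiff, Set.mem_preimage]
        constructor <;> rintro ⟨h1, h2⟩ <;> refine ⟨?_, h2⟩
        · rwa [hYout k ω h2] at h1
        · rwa [hYout k ω h2]
    -- Integrating the covering numbers over `C` locates `m`.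
    have hint : ∫ ω in C, ∑ k ∈ Finset.range N, (H k).indicator (fun _ => (1 : ℝ)) ω ∂μ =
        N * μ.real G := by
      rw [integral_finsetSum _ fun k _ => (integrable_const 1).indicator (hH k).1]
      have : ∀ k ∈ Finset.range N,
          ∫ ω in C, (H k).indicator (fun _ => (1 : ℝ)) ω ∂μ = μ.real G := by
        intro k _
        rw [setIntegral_indicator (hH k).1, Set.inter_eq_right.2 (hH k).2.1]
        simp [(hH k).2.2]
      rw [Finset.sum_congr rfl this]
      simp
    have hSint : IntegrableOn
        (fun ω => ∑ k ∈ Finset.range N, (H k).indicator (fun _ => (1 : ℝ)) ω) C μ :=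
      integrable_finsetSum _ fun k _ => (integrable_const 1).indicator (hH k).1
    have hm1 : m * μ.real C ≤ N * μ.real G := by
      rw [← hint]
      calc m * μ.real C = ∫ _ in C, m ∂μ := by simp [mul_comm]
        _ ≤ _ := setIntegral_mono_on (integrable_const m) hSint hC fun ω hω => by
          rcases hm ω hω with h | h <;> rw [h]; linarith
    have hm2 : N * μ.real G ≤ (m + 1) * μ.real C := by
      rw [← hint]
      calc _ ≤ ∫ _ in C, (m + 1) ∂μ :=
            setIntegral_mono_on hSint (integrable_const _) hC fun ω hω => by
              rcases hm ω hω with h | h <;> rw [h]; linarith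
        _ = _ := by simp [mul_comm]
    have hr1 : m / N ≤ μ.real G / μ.real C := by
      rw [div_le_div_iff₀ hN0 hC0]; linarith
    have hr2 : μ.real G / μ.real C ≤ (m + 1) / N := by
      rw [div_le_div_iff₀ hC0 hN0]; linarith
    let avg : SimpleFunc Ω ℝ := (1 / (N : ℝ)) • ∑ k ∈ Finset.range N, Y k
    have havg : F avg ≤ F f := by
      rw [hF.posHom _ _ (by positivity)]
      have := hF.sum_le hlaw N
      calc 1 / (N : ℝ) * F (∑ k ∈ Finset.range N, Y k) ≤ 1 / (N : ℝ) * (N * F f) := by gcongr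
        _ = F f := by field_simp
    have hle : ∀ ω, h ω ≤ (avg + SimpleFunc.const Ω (|a - b| * (1 / N))) ω := by
      intro ω
      have hsum : ∀ M, (∑ k ∈ Finset.range M, Y k) ω = ∑ k ∈ Finset.range M, Y k ω := by
        intro M
        induction M with
        | zero => simp
        | succ M ih =>
          rw [Finset.sum_range_succ, Finset.sum_range_succ, SimpleFunc.coe_add, Pi.add_apply, ih]
      have hav : avg ω = 1 / (N : ℝ) * ∑ k ∈ Finset.range N, Y k ω := by
        simp only [avg, SimpleFunc.coe_smul, Pi.smul_apply, smul_eq_mul, hsum]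
      rw [SimpleFunc.coe_add, Pi.add_apply, hav, SimpleFunc.coe_const, Function.const_apply]
      by_cases hω : ω ∈ C
      · rw [hin ω hω, Finset.sum_congr rfl fun k _ => hYC k ω hω, Finset.sum_add_distrib,
          ← Finset.mul_sum]
        set S := ∑ k ∈ Finset.range N, (H k).indicator (fun _ => (1 : ℝ)) ω with hS
        have hS1 : |μ.real G / μ.real C - S / N| ≤ 1 / N := by
          rw [add_div] at hr2
          rw [abs_le]
          rcases hm ω hω with h | h <;> rw [← hS] at h <;> rw [h] <;> try rw [add_div]
          all_goals constructor <;> linarith [(by positivity : (0 : ℝ) < 1 / N)]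
        have : (a - b) * (μ.real G / μ.real C - S / N) ≤ |a - b| * (1 / N) :=
          (le_abs_self _).trans ((abs_mul _ _).le.trans (by gcongr))
        have hre : 1 / (N : ℝ) * (∑ k ∈ Finset.range N, b + (a - b) * S) =
            b + (a - b) * (S / N) := by
          simp only [Finset.sum_const, Finset.card_range, nsmul_eq_mul]
          field_simp
        rw [hre]
        linarith
      · rw [hout ω hω, Finset.sum_congr rfl fun k _ => hYout k ω hω]
        simp only [Finset.sum_const, Finset.card_range, nsmul_eq_mul]
        have h1 : 1 / (N : ℝ) * (N * f ω) = f ω := by field_simp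
        rw [h1]
        have : 0 ≤ |a - b| * (1 / (N : ℝ)) := by positivity
        linarith
    calc F h ≤ F (avg + SimpleFunc.const Ω (|a - b| * (1 / N))) := hF.mono _ _ hle
      _ = F avg + |a - b| * (1 / N) := hF.translation _ _
      _ ≤ _ := by linarith
  have hlim : Filter.Tendsto (fun n : ℕ => F f + |a - b| * (1 / ((n : ℝ) + 1))) Filter.atTop
      (nhds (F f + |a - b| * 0)) :=
    (tendsto_one_div_add_atTop_nhds_zero_nat.const_mul _).const_add _
  simpa using ge_of_tendsto' hlim key

/-- A transfer of mass from a cell with a larger value to one with a smaller value, not overtaking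
it, does not increase the risk: the result is a convex combination of the original loss and of its
average over the two cells. -/
lemma IsSimpleRisk.transfer_le (hF : IsSimpleRisk μ F) (hμ : Nonatomic μ) {ι : Type*}
    [DecidableEq ι] (κ : SimpleFunc Ω ι) (y : ι → ℝ) {i j : ι} (hij : i ≠ j)
    (hi : 0 < μ.real (κ ⁻¹' {i})) (hj : 0 < μ.real (κ ⁻¹' {j})) {δ : ℝ} (hδ : 0 ≤ δ)
    (hle : y i + δ / μ.real (κ ⁻¹' {i}) ≤ y j - δ / μ.real (κ ⁻¹' {j})) :
    F (κ.map (Function.update (Function.update y i (y i + δ / μ.real (κ ⁻¹' {i}))) j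
      (y j - δ / μ.real (κ ⁻¹' {j})))) ≤ F (κ.map y) := by
  set p := μ.real (κ ⁻¹' {i})
  set q := μ.real (κ ⁻¹' {j})
  have hmi := κ.measurableSet_fiber i
  have hmj := κ.measurableSet_fiber j
  have hdisj : Disjoint (κ ⁻¹' {i}) (κ ⁻¹' {j}) :=
    Set.disjoint_left.2 fun ω h1 h2 => hij (h1.symm.trans h2)
  have hpq : μ.real (κ ⁻¹' {i} ∪ κ ⁻¹' {j}) = p + q := measureReal_union hdisj hmj
  let v := y j + (y i - y j) * (p / (p + q))
  let z : ι → ℝ := Function.update (Function.update y i v) j v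
  have hz : F (κ.map z) ≤ F (κ.map y) := by
    refine hF.average_le hμ (hmi.union hmj) hmi Set.subset_union_left (by rw [hpq]; positivity)
      (a := y i) (b := y j) (fun ω hω => ?_) (fun ω hω => ?_) (fun ω hω => ?_) fun ω hω => ?_
    · have : κ ω = i := hω
      simp [this]
    · have : κ ω = j := hω.1.resolve_left hω.2
      simp [this]
    · have h1 : κ ω ≠ i := fun h => hω (Or.inl h)
      have h2 : κ ω ≠ j := fun h => hω (Or.inr h)
      simp [z, h1, h2]
    · rw [hpq]
      rcases hω with h | h
      · have : κ ω = i := h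
        simp [z, this, hij, v, p, q]
      · have : κ ω = j := h
        simp [z, this, v, p, q]
  have hδp : 0 ≤ δ / p := by positivity
  have hδq : 0 ≤ δ / q := by positivity
  by_cases hg : y j - y i = 0
  · have h1 : δ / p = 0 := by linarith
    have h2 : δ / q = 0 := by linarith
    simp [h1, h2]
  · have hg : 0 < y j - y i := lt_of_le_of_ne (by linarith) (Ne.symm hg)
    let θ := δ * (p + q) / (p * q * (y j - y i))
    have hθ0 : 0 ≤ θ := by positivity
    have hθ1 : θ ≤ 1 := by
      rw [div_le_one (by positivity)]
      have : δ / p + δ / q ≤ y j - y i := by linarith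
      calc δ * (p + q) = (δ / p + δ / q) * (p * q) := by field_simp; ring
        _ ≤ (y j - y i) * (p * q) := by gcongr
        _ = _ := by ring
    have hcomb : κ.map (Function.update (Function.update y i (y i + δ / p)) j (y j - δ / q)) =
        (1 - θ) • κ.map y + θ • κ.map z := by
      ext ω
      simp only [SimpleFunc.map_apply, SimpleFunc.coe_add, SimpleFunc.coe_smul, Pi.add_apply,
        Pi.smul_apply, smul_eq_mul]
      have hne := hg.ne'
      by_cases h2 : κ ω = j
      · simp only [h2, z, Function.update_self, v, θ]
        field_simp
        ring
      · by_cases h1 : κ ω = i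
        · simp only [h1, z, Function.update_of_ne hij, Function.update_self, v, θ]
          field_simp
          ring
        · simp only [z, Function.update_of_ne h1, Function.update_of_ne h2]
          ring
    rw [hcomb]
    have h1 := hF.subadd ((1 - θ) • κ.map y) (θ • κ.map z)
    rw [hF.posHom _ _ (by linarith), hF.posHom _ _ hθ0] at h1
    nlinarith

end SimpleRisk

/-! ### Weighted majorization -/

section Majorization

variable {Ω : Type*} [MeasurableSpace Ω] {μ : Measure Ω} [IsFiniteMeasure μ]
  {F : SimpleFunc Ω ℝ → ℝ}

/-- If the terms of an upper set `U` below `j ∈ U` are nonnegative and the terms above `j` have a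
nonnegative sum, then the sum over `U` is at least the term at `j`. -/
lemma le_sum_upperSet {ι : Type*} [LinearOrder ι] (s : Finset ι) (d : ι → ℝ) {U : Set ι}
    [DecidablePred (· ∈ U)] (hU : IsUpperSet U) {j : ι} (hjs : j ∈ s) (hjU : j ∈ U)
    (hbelow : ∀ l ∈ s, l ∈ U → l < j → 0 ≤ d l) (hj : 0 ≤ d j)
    (habove : 0 ≤ ∑ l ∈ s with j < l, d l) : d j ≤ ∑ l ∈ s with l ∈ U, d l := by
  have hsplit : ∑ l ∈ s with l ∈ U, d l =
      (∑ l ∈ s with j < l, d l) + ∑ l ∈ s with l ∈ U ∧ l ≤ j, d l := by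
    rw [← Finset.sum_filter_add_sum_filter_not (s.filter (· ∈ U)) (fun l => j < l)]
    simp only [Finset.filter_filter, not_lt]
    congr 1
    refine Finset.sum_congr (Finset.filter_congr fun l _ => ?_) fun _ _ => rfl
    exact ⟨fun h => h.2, fun h => ⟨hU h.le hjU, h⟩⟩
  have hsingle : d j ≤ ∑ l ∈ s with l ∈ U ∧ l ≤ j, d l := by
    refine Finset.single_le_sum (f := d) (fun l hl => ?_) (by simp [hjs, hjU])
    obtain ⟨hls, hlU, hlj⟩ := Finset.mem_filter.1 hl
    rcases hlj.lt_or_eq with h | rfl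
    · exact hbelow l hls hlU h
    · exact hj
  linarith

open Classical in
/-- Weighted majorization (Hardy–Littlewood–Pólya): on the cells of `κ`, if `x` is increasing and
the weighted tail sums of `y` dominate those of `x`, then `x ∘ κ` is not riskier than `y ∘ κ`. Each
step of the induction makes `y` agree with `x` on one more cell, by lowering a value of `y` or by
transferring mass to the nearest lower cell where `y` is too small. -/
lemma IsSimpleRisk.le_of_tail_sums (hF : IsSimpleRisk μ F) (hμ : Nonatomic μ) {ι : Type*}
    [LinearOrder ι] (κ : SimpleFunc Ω ι) {x : ι → ℝ} (hx : Monotone x) (y : ι → ℝ)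
    (htail : ∀ U : Set ι, IsUpperSet U →
      0 ≤ ∑ l ∈ κ.range with l ∈ U, μ.real (κ ⁻¹' {l}) * (y l - x l)) :
    F (κ.map x) ≤ F (κ.map y) := by
  let w : ι → ℝ := fun l => μ.real (κ ⁻¹' {l})
  let bad : (ι → ℝ) → Finset ι := fun y => κ.range.filter fun l => w l * (y l - x l) ≠ 0
  induction hn : (bad y).card using Nat.strong_induction_on generalizing y with
  | _ n ih =>
  have hw : ∀ l, 0 ≤ w l := fun l => measureReal_nonneg
  have hwpos : ∀ {l}, w l * (y l - x l) ≠ 0 → 0 < w l := fun h =>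
    lt_of_le_of_ne (hw _) (Ne.symm (left_ne_zero_of_mul h))
  -- The tail above a cell is indexed by an upper set.
  have habove : ∀ j, 0 ≤ ∑ l ∈ κ.range with j < l, w l * (y l - x l) := fun j => by
    simpa using htail (Set.Ioi j) (isUpperSet_Ioi j)
  have hdone : ∀ y' : ι → ℝ, bad y' ⊂ bad y → F (κ.map y') ≤ F (κ.map y) →
      (∀ U : Set ι, IsUpperSet U → 0 ≤ ∑ l ∈ κ.range with l ∈ U, w l * (y' l - x l)) →
      F (κ.map x) ≤ F (κ.map y) := fun y' hb hle ht =>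
    (ih _ (hn ▸ Finset.card_lt_card hb) y' ht rfl).trans hle
  by_cases hex : ∃ j ∈ κ.range, 0 < w j * (y j - x j)
  · obtain ⟨j, hj, hdj⟩ := hex
    have hwj : 0 < w j := hwpos hdj.ne'
    have hxy : x j < y j := by
      by_contra! h
      nlinarith
    by_cases hi : (κ.range.filter fun i => i < j ∧ w i * (y i - x i) < 0).Nonempty
    · obtain ⟨i, hi, himax⟩ := Finset.exists_max_image _ id hi
      obtain ⟨hir, hij, hdi⟩ := Finset.mem_filter.1 hi
      have hwi : 0 < w i := hwpos hdi.ne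
      let δ := min (w j * (y j - x j)) (-(w i * (y i - x i)))
      have hδ : 0 < δ := lt_min hdj (neg_pos.2 hdi)
      have hi1 : y i + δ / w i ≤ x i := by
        have : δ / w i ≤ x i - y i := by
          rw [div_le_iff₀ hwi]
          exact (min_le_right _ _).trans (by linarith)
        linarith
      have hj1 : x j ≤ y j - δ / w j := by
        have : δ / w j ≤ y j - x j := by
          rw [div_le_iff₀ hwj]
          exact (min_le_left _ _).trans (by linarith)
        linarith
      let y' := Function.update (Function.update y i (y i + δ / w i)) j (y j - δ / w j)
      have hdi' : w i * (y' i - x i) = w i * (y i - x i) + δ := by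
        simp only [y', Function.update_of_ne hij.ne, Function.update_self]
        field_simp
        ring
      have hdj' : w j * (y' j - x j) = w j * (y j - x j) - δ := by
        simp only [y', Function.update_self]
        field_simp
        ring
      have hd' : ∀ l, l ≠ i → l ≠ j → y' l = y l := fun l h1 h2 => by
        simp [y', h1, h2]
      refine hdone y' ?_ (hF.transfer_le hμ κ y hij.ne hwi hwj hδ.le
        (hi1.trans ((hx hij.le).trans hj1))) fun U hU => ?_
      · refine Finset.ssubset_iff_subset_ne.2 ⟨fun l hl => ?_, fun heq => ?_⟩
        · obtain ⟨hlr, hl0⟩ := Finset.mem_filter.1 hl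
          refine Finset.mem_filter.2 ⟨hlr, ?_⟩
          by_cases h1 : l = i
          · exact h1 ▸ hdi.ne
          by_cases h2 : l = j
          · exact h2 ▸ hdj.ne'
          rwa [hd' l h1 h2] at hl0
        · have hib : i ∈ bad y' := heq ▸ Finset.mem_filter.2 ⟨hir, hdi.ne⟩
          have hjb : j ∈ bad y' := heq ▸ Finset.mem_filter.2 ⟨hj, hdj.ne'⟩
          have h1 := (Finset.mem_filter.1 hib).2
          have h2 := (Finset.mem_filter.1 hjb).2
          rw [hdi'] at h1
          rw [hdj'] at h2
          rcases min_choice (w j * (y j - x j)) (-(w i * (y i - x i))) with h | h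
          · exact h2 (by simp only [δ, h]; ring)
          · exact h1 (by simp only [δ, h]; ring)
      · have hchange : ∑ l ∈ κ.range with l ∈ U, w l * (y' l - x l) =
            (∑ l ∈ κ.range with l ∈ U, w l * (y l - x l)) + (if i ∈ U then δ else 0) -
              (if j ∈ U then δ else 0) := by
          have : ∀ l ∈ κ.range.filter (· ∈ U), w l * (y' l - x l) = w l * (y l - x l) +
              (if i = l then δ else 0) - (if j = l then δ else 0) := by
            intro l _
            by_cases h1 : l = i
            · subst h1; rw [hdi']; simp [hij.ne']
            by_cases h2 : l = j
            · subst h2; rw [hdj']; simp [hij.ne]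
            rw [hd' l h1 h2]; simp [Ne.symm h1, Ne.symm h2]
          rw [Finset.sum_congr rfl this, Finset.sum_sub_distrib, Finset.sum_add_distrib,
            Finset.sum_ite_eq, Finset.sum_ite_eq]
          simp [hir, hj]
        rw [hchange]
        have h0 := htail U hU
        by_cases hjU : j ∈ U
        · by_cases hiU : i ∈ U
          · simpa [hiU, hjU] using h0
          · have := le_sum_upperSet κ.range (fun l => w l * (y l - x l)) hU hj hjU
              (fun l hl hlU hlj => ?_) hdj.le (habove j)
            · have h3 : δ ≤ w j * (y j - x j) := min_le_left _ _
              simp only [hiU, hjU, if_true, if_false]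
              linarith
            · by_contra! hneg
              have hli : l ≤ i := himax l (Finset.mem_filter.2 ⟨hl, hlj, hneg⟩)
              exact hiU (hU hli hlU)
        · by_cases hiU : i ∈ U
          · simp only [hiU, hjU, if_true, if_false]
            linarith
          · simpa [hiU, hjU] using h0
    · have hnonneg : ∀ l ∈ κ.range, l < j → 0 ≤ w l * (y l - x l) := by
        intro l hl hlj
        by_contra! hneg
        exact hi ⟨l, Finset.mem_filter.2 ⟨hl, hlj, hneg⟩⟩
      let y' := Function.update y j (x j)
      have hd' : ∀ l, l ≠ j → y' l = y l := fun l h => by simp [y', h]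
      have hdj' : y' j = x j := by simp [y']
      refine hdone y' ?_ (hF.mono _ _ fun ω => ?_) fun U hU => ?_
      · refine Finset.ssubset_iff_subset_ne.2 ⟨fun l hl => ?_, fun heq => ?_⟩
        · obtain ⟨hlr, hl0⟩ := Finset.mem_filter.1 hl
          refine Finset.mem_filter.2 ⟨hlr, ?_⟩
          by_cases h2 : l = j
          · exact h2 ▸ hdj.ne'
          rwa [hd' l h2] at hl0
        · have hjb : j ∈ bad y' := heq ▸ Finset.mem_filter.2 ⟨hj, hdj.ne'⟩
          exact (Finset.mem_filter.1 hjb).2 (by rw [hdj']; ring)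
      · simp only [SimpleFunc.map_apply]
        by_cases h : κ ω = j
        · rw [h, hdj']; exact hxy.le
        · rw [hd' _ h]
      · have hchange : ∑ l ∈ κ.range with l ∈ U, w l * (y' l - x l) =
            (∑ l ∈ κ.range with l ∈ U, w l * (y l - x l)) -
              (if j ∈ U then w j * (y j - x j) else 0) := by
          have : ∀ l ∈ κ.range.filter (· ∈ U), w l * (y' l - x l) = w l * (y l - x l) -
              (if j = l then w j * (y j - x j) else 0) := by
            intro l _
            by_cases h2 : l = j
            · subst h2; rw [hdj']; simp
            rw [hd' l h2]; simp [Ne.symm h2]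
          rw [Finset.sum_congr rfl this, Finset.sum_sub_distrib, Finset.sum_ite_eq]
          simp [hj]
        rw [hchange]
        by_cases hjU : j ∈ U
        · have := le_sum_upperSet κ.range (fun l => w l * (y l - x l)) hU hj hjU
            (fun l hl _ hlj => hnonneg l hl hlj) hdj.le (habove j)
          simp only [hjU, if_true]
          linarith
        · simpa [hjU] using htail U hU
  · push Not at hex
    -- No excess anywhere, so the total tail forces equality on every cell of positive measure.
    have hzero : ∀ l ∈ κ.range, w l * (y l - x l) = 0 := by
      have h0 : 0 ≤ ∑ l ∈ κ.range, w l * (y l - x l) := by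
        simpa using htail Set.univ isUpperSet_univ
      have h1 : ∑ l ∈ κ.range, w l * (y l - x l) = 0 := (Finset.sum_nonpos hex).antisymm h0
      exact (Finset.sum_eq_zero_iff_of_nonpos hex).1 h1
    refine (hF.lawInv _ _ (Measure.map_congr ?_)).le
    have hae : ∀ l ∈ κ.range, ∀ᵐ ω ∂μ, κ ω = l → x l = y l := by
      intro l hl
      rcases mul_eq_zero.1 (hzero l hl) with h | h
      · have : μ (κ ⁻¹' {l}) = 0 := (measureReal_eq_zero_iff).1 h
        filter_upwards [measure_eq_zero_iff_ae_notMem.1 this] with ω hω h'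
        exact absurd h' hω
      · exact .of_forall fun _ _ => by linarith
    filter_upwards [(Finset.eventually_all κ.range).2 hae] with ω hω
    simpa using hω (κ ω) (κ.mem_range_self ω) rfl

end Majorization

/-! ### Comonotone couplings -/

section Coupling

variable {Ω : Type*} [MeasurableSpace Ω] {μ : Measure Ω} [IsFiniteMeasure μ]

/-- In a nonatomic space, a simple random variable `X` has upper level sets of every measure, ties
being split by a subset of a level set. -/
lemma Nonatomic.exists_upper_subset (hμ : Nonatomic μ) (X : SimpleFunc Ω ℝ) {A : Set Ω}
    (hA : MeasurableSet A) {q : ℝ} (hq0 : 0 ≤ q) (hqA : q ≤ μ.real A) :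
    ∃ G, MeasurableSet G ∧ G ⊆ A ∧ μ.real G = q ∧ ∀ ω ∈ G, ∀ ω' ∈ A, X ω < X ω' → ω' ∈ G := by
  have key : ∀ (s : Finset ℝ) (A : Set Ω), MeasurableSet A → (∀ ω ∈ A, X ω ∈ s) →
      ∀ q, 0 ≤ q → q ≤ μ.real A → ∃ G, MeasurableSet G ∧ G ⊆ A ∧ μ.real G = q ∧
        ∀ ω ∈ G, ∀ ω' ∈ A, X ω < X ω' → ω' ∈ G := by
    intro s
    induction s using Finset.induction_on_max with
    | empty =>
      intro A _ hs q hq0 hqA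
      have : A = ∅ := Set.eq_empty_of_forall_notMem fun ω hω => by simpa using hs ω hω
      subst this
      exact ⟨∅, .empty, subset_rfl, by simp at hqA ⊢; linarith, by simp⟩
    | insert v s hv ih =>
      intro A hA hs q hq0 hqA
      let T := A ∩ X ⁻¹' {v}
      have hT : MeasurableSet T := hA.inter (X.measurableSet_fiber v)
      have hmax : ∀ ω ∈ A, X ω ≤ v := fun ω hω => by
        rcases Finset.mem_insert.1 (hs ω hω) with h | h
        · exact h.le
        · exact (hv _ h).le
      by_cases hq : q ≤ μ.real T
      · obtain ⟨G, hG, hGT, hGq⟩ := hμ.exists_subset_measureReal_eq hT hq0 hq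
        refine ⟨G, hG, hGT.trans Set.inter_subset_left, hGq, fun ω hω ω' hω' hlt => ?_⟩
        have : X ω = v := (hGT hω).2
        exact absurd (hmax ω' hω') (by linarith)
      · push Not at hq
        have hdiff : μ.real (A \ T) = μ.real A - μ.real T :=
          measureReal_sdiff Set.inter_subset_left hT
        obtain ⟨G, hG, hGA, hGq, hup⟩ := ih (A \ T) (hA.diff hT)
          (fun ω hω => (Finset.mem_insert.1 (hs ω hω.1)).resolve_left fun h => hω.2 ⟨hω.1, h⟩)
          (q - μ.real T) (by linarith) (by linarith)
        refine ⟨T ∪ G, hT.union hG,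
          Set.union_subset Set.inter_subset_left (hGA.trans Set.sdiff_subset), ?_, ?_⟩
        · rw [measureReal_union (Set.disjoint_left.2 fun x hx hx' => (hGA hx').2 hx) hG, hGq]
          ring
        · intro ω hω ω' hω' hlt
          by_cases h : ω' ∈ T
          · exact Or.inl h
          · rcases hω with hω | hω
            · have : X ω = v := hω.2
              exact absurd (hmax ω' hω') (by linarith)
            · exact Or.inr (hup ω hω ω' ⟨hω', h⟩ hlt)
  exact key X.range A hA (fun ω _ => X.mem_range_self ω) q hq0 hqA

/-- Comonotone coupling: a simple law has a version that is increasing in a given simple random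
variable `X`. The top value is placed on an upper level set of `X`, and so on downwards. -/
lemma Nonatomic.exists_comonotone (hμ : Nonatomic μ) (X Y : SimpleFunc Ω ℝ) :
    ∃ Z : SimpleFunc Ω ℝ, μ.map Z = μ.map Y ∧ ∀ ω ω', X ω < X ω' → Z ω ≤ Z ω' := by
  have key : ∀ (s : Finset ℝ) (A : Set Ω) (w : ℝ → ℝ) (b : ℝ), MeasurableSet A → (∀ v, 0 ≤ w v) →
      ∑ v ∈ s, w v = μ.real A → (∀ v ∈ s, v ≤ b) → ∃ Z : SimpleFunc Ω ℝ,
        (∀ T : Set ℝ, MeasurableSet T → μ.real (A ∩ Z ⁻¹' T) = ∑ v ∈ s, T.indicator w v) ∧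
        (∀ ω ∈ A, Z ω ≤ b) ∧ ∀ ω ∈ A, ∀ ω' ∈ A, X ω < X ω' → Z ω ≤ Z ω' := by
    intro s
    induction s using Finset.induction_on_max with
    | empty =>
      intro A w b _ _ hs _
      refine ⟨SimpleFunc.const Ω b, fun T _ => ?_, by simp, by simp⟩
      simp only [Finset.sum_empty] at hs ⊢
      exact measureReal_mono_null Set.inter_subset_left hs.symm
    | insert v s hv ih =>
      intro A w b hA hw hs hb
      have hvs : v ∉ s := fun h => (hv v h).false
      rw [Finset.sum_insert hvs] at hs
      have hsum0 : 0 ≤ ∑ v ∈ s, w v := Finset.sum_nonneg fun v _ => hw v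
      obtain ⟨G, hG, hGA, hGq, hup⟩ := hμ.exists_upper_subset X hA (hw v) (by linarith)
      obtain ⟨Z, hlaw, hZv, hmono⟩ := ih (A \ G) w v (hA.diff hG) hw
        (by rw [measureReal_sdiff hGA hG]; linarith) fun u hu => (hv u hu).le
      refine ⟨SimpleFunc.piecewise G hG (.const Ω v) Z, fun T hT => ?_, fun ω hω => ?_,
        fun ω hω ω' hω' hlt => ?_⟩
      · rw [Finset.sum_insert hvs, ← hlaw T hT, ← measureReal_inter_add_sdiff (s := A ∩ _) hG]
        congr 1
        · by_cases hvT : v ∈ T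
          · rw [Set.indicator_of_mem hvT, ← hGq]
            congr 1
            ext ω
            simp only [Set.mem_inter_iff, Set.mem_preimage]
            refine ⟨fun h => h.2, fun h => ⟨⟨hGA h, by simpa [h] using hvT⟩, h⟩⟩
          · rw [Set.indicator_of_notMem hvT]
            have : A ∩ (SimpleFunc.piecewise G hG (.const Ω v) Z) ⁻¹' T ∩ G = ∅ := by
              refine Set.eq_empty_of_forall_notMem fun ω hω => hvT ?_
              have := hω.1.2
              simpa [hω.2] using this
            rw [this, measureReal_empty]
        · congr 1
          ext ω
          simp only [Set.mem_sdiff, Set.mem_inter_iff, Set.mem_preimage]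
          constructor
          · rintro ⟨⟨h1, h2⟩, h3⟩
            exact ⟨⟨h1, h3⟩, by simpa [h3] using h2⟩
          · rintro ⟨⟨h1, h3⟩, h2⟩
            exact ⟨⟨h1, by simpa [h3] using h2⟩, h3⟩
      · have hvb := hb v (Finset.mem_insert_self v s)
        by_cases h : ω ∈ G
        · simpa [h] using hvb
        · simpa [h] using (hZv ω ⟨hω, h⟩).trans hvb
      · by_cases h : ω ∈ G
        · simp [h, hup ω h ω' hω' hlt]
        · by_cases h' : ω' ∈ G
          · simpa [h, h'] using hZv ω ⟨hω, h⟩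
          · simpa [h, h'] using hmono ω ⟨hω, h⟩ ω' ⟨hω', h'⟩ hlt
  have hYlaw : ∀ T : Set ℝ,
      μ.real (Y ⁻¹' T) = ∑ v ∈ Y.range, T.indicator (fun v => μ.real (Y ⁻¹' {v})) v := by
    classical
    intro T
    have h := Y.sum_measure_preimage_singleton (μ := μ) (Y.range.filter (· ∈ T))
    have hT : (Y ⁻¹' ↑(Y.range.filter (· ∈ T)) : Set Ω) = Y ⁻¹' T := by
      ext ω
      simp
    rw [hT] at h
    rw [Measure.real, ← h, ENNReal.toReal_sum fun _ _ => measure_ne_top _ _, Finset.sum_filter]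
    exact Finset.sum_congr rfl fun v _ => by simp [Set.indicator_apply, Measure.real]
  obtain ⟨b, hb⟩ := Y.range.bddAbove
  obtain ⟨Z, hlaw, -, hmono⟩ := key Y.range Set.univ (fun v => μ.real (Y ⁻¹' {v})) b .univ
    (fun v => measureReal_nonneg) (by simpa using (hYlaw Set.univ).symm) fun v hv => hb hv
  refine ⟨Z, ?_, fun ω ω' => hmono ω trivial ω' trivial⟩
  ext T hT
  rw [Measure.map_apply Z.measurable hT, Measure.map_apply Y.measurable hT,
    ← measureReal_eq_measureReal_iff, hYlaw T, ← hlaw T hT, Set.univ_inter]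

end Coupling

/-! ### The stop-loss order for simple losses -/

section SimpleOrder

variable {Ω : Type*} [MeasurableSpace Ω] {μ : Measure Ω} [IsFiniteMeasure μ]
  {F : SimpleFunc Ω ℝ → ℝ}

lemma integral_map_simpleFunc {ι : Type*} (κ : SimpleFunc Ω ι) (h : ι → ℝ) :
    ∫ ω, h (κ ω) ∂μ = ∑ l ∈ κ.range, μ.real (κ ⁻¹' {l}) * h l := by
  classical
  have hsum : ∀ ω, h (κ ω) = ∑ l ∈ κ.range, (κ ⁻¹' {l}).indicator (fun _ => h l) ω := by
    intro ω
    rw [Finset.sum_eq_single_of_mem (κ ω) (κ.mem_range_self ω)]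
    · simp
    · intro l _ hl
      exact Set.indicator_of_notMem (fun h => hl (Eq.symm h)) _
  simp_rw [hsum]
  rw [integral_finsetSum _ fun l _ => (integrable_const _).indicator (κ.measurableSet_fiber l)]
  refine Finset.sum_congr rfl fun l _ => ?_
  rw [integral_indicator_const _ (κ.measurableSet_fiber l), smul_eq_mul]

lemma SimpleFunc.integrable_max_sub (f : SimpleFunc Ω ℝ) (t : ℝ) :
    Integrable (fun ω => max (f ω - t) 0) μ :=
  (f.map fun r => max (r - t) 0).integrable_of_isFiniteMeasure

/-- Monotonicity of a law-invariant coherent risk measure in the increasing convex order, for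
simple losses. Once `Y` has been made comonotone with `X`, an upper tail of the joint cells is an
upper level set of `Y`, on which the stop-loss inequality at the lowest value of `Y` gives the
inequality of tail sums. -/
lemma IsSimpleRisk.le_of_stopLoss (hF : IsSimpleRisk μ F) (hμ : Nonatomic μ)
    (X Y : SimpleFunc Ω ℝ)
    (h : ∀ t : ℝ, ∫ ω, max (X ω - t) 0 ∂μ ≤ ∫ ω, max (Y ω - t) 0 ∂μ) : F X ≤ F Y := by
  classical
  obtain ⟨Z, hZY, hcom⟩ := hμ.exists_comonotone X Y
  let κ : SimpleFunc Ω (ℝ ×ₗ ℝ) := (X.pair Z).map toLex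
  have hx : Monotone fun l : ℝ ×ₗ ℝ => (ofLex l).1 := Prod.Lex.monotone_fst
  have hκ : ∀ ω ω', κ ω ≤ κ ω' → Z ω ≤ Z ω' := by
    intro ω ω' hle
    rcases Prod.Lex.le_iff.1 hle with h | h
    · exact hcom ω ω' h
    · exact h.2
  rw [← hF.lawInv Z Y hZY]
  refine hF.le_of_tail_sums hμ κ hx (fun l => (ofLex l).2) fun U hU => ?_
  rcases (κ.range.filter (· ∈ U)).eq_empty_or_nonempty with hem | hne
  · rw [hem, Finset.sum_empty]
  obtain ⟨m, hmU, hmin⟩ := Finset.exists_min_image _ id hne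
  obtain ⟨hmr, hmU⟩ := Finset.mem_filter.1 hmU
  obtain ⟨ω₀, rfl⟩ := SimpleFunc.mem_range.1 hmr
  have hint : ∑ l ∈ κ.range with l ∈ U, μ.real (κ ⁻¹' {l}) * ((ofLex l).2 - (ofLex l).1) =
      ∫ ω, (if κ ω ∈ U then Z ω - X ω else 0) ∂μ := by
    have := integral_map_simpleFunc (μ := μ) κ
      fun l => if l ∈ U then (ofLex l).2 - (ofLex l).1 else 0
    rw [Finset.sum_filter]
    refine (Eq.trans ?_ this.symm)
    exact Finset.sum_congr rfl fun l _ => by split_ifs <;> simp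
  rw [hint]
  have hZt : ∫ ω, max (Z ω - Z ω₀) 0 ∂μ = ∫ ω, max (Y ω - Z ω₀) 0 ∂μ := by
    have hm : Measurable fun r : ℝ => max (r - Z ω₀) 0 := by fun_prop
    rw [← integral_map Z.measurable.aemeasurable (f := fun r => max (r - Z ω₀) 0)
        hm.aestronglyMeasurable, hZY,
      integral_map Y.measurable.aemeasurable hm.aestronglyMeasurable]
  have hstep : ∫ ω, (max (Z ω - Z ω₀) 0 - max (X ω - Z ω₀) 0) ∂μ ≤
      ∫ ω, (if κ ω ∈ U then Z ω - X ω else 0) ∂μ := by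
    refine integral_mono ((SimpleFunc.integrable_max_sub Z _).sub
      (SimpleFunc.integrable_max_sub X _)) (κ.map fun l =>
        if l ∈ U then (ofLex l).2 - (ofLex l).1 else 0).integrable_of_isFiniteMeasure fun ω => ?_
    by_cases hω : κ ω ∈ U
    · have h1 : Z ω₀ ≤ Z ω :=
        hκ _ _ (hmin (κ ω) (Finset.mem_filter.2 ⟨κ.mem_range_self ω, hω⟩))
      simp only [hω, if_true, max_eq_left (sub_nonneg.2 h1)]
      linarith [le_max_left (X ω - Z ω₀) 0]
    · have h1 : Z ω ≤ Z ω₀ := hκ _ _ (le_of_not_ge fun hle => hω (hU hle hmU))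
      simp only [hω, if_false, max_eq_right (sub_nonpos.2 h1)]
      linarith [le_max_right (X ω - Z ω₀) 0]
  rw [integral_sub (SimpleFunc.integrable_max_sub Z _) (SimpleFunc.integrable_max_sub X _),
    hZt] at hstep
  linarith [h (Z ω₀)]

end SimpleOrder

/-! ### Coherent risk measures on `L^p` and the increasing convex order -/

section LpRisk

variable {Ω : Type*} [MeasurableSpace Ω] {μ : Measure Ω} {p : ℝ≥0∞}

lemma integral_smul_Lp (t : ℝ) (X : Lp ℝ p μ) : ∫ ω, (t • X) ω ∂μ = t * ∫ ω, X ω ∂μ := by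
  rw [integral_congr_ae (Lp.coeFn_smul t X)]
  exact integral_const_mul t _

lemma exists_simpleFunc_ae_bound {f : Ω → ℝ} (hf : Measurable f) {M : ℝ}
    (hM : ∀ᵐ ω ∂μ, |f ω| ≤ M) {ε : ℝ} (hε : 0 < ε) :
    ∃ g : SimpleFunc Ω ℝ, ∀ᵐ ω ∂μ, |f ω - g ω| ≤ ε := by
  let φ : Ω → ℝ := fun ω => ε * (⌊max (-M) (min M (f ω)) / ε⌋ : ℤ)
  have hφ : Measurable φ := by
    have : Measurable fun ω => ⌊max (-M) (min M (f ω)) / ε⌋ :=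
      Int.measurable_floor.comp (by fun_prop)
    exact (measurable_from_top (f := fun n : ℤ => ε * (n : ℝ))).comp this
  have hfin : (Set.range φ).Finite := by
    refine ((Set.finite_Icc ⌊-|M| / ε⌋ ⌊|M| / ε⌋).image fun n : ℤ => ε * (n : ℝ)).subset ?_
    rintro _ ⟨ω, rfl⟩
    refine ⟨_, ⟨Int.floor_mono ?_, Int.floor_mono ?_⟩, rfl⟩ <;>
      refine div_le_div_of_nonneg_right ?_ hε.le
    · exact (neg_le_neg (le_abs_self M)).trans (le_max_left _ _)
    · exact max_le (neg_le_abs M) ((min_le_left _ _).trans (le_abs_self M))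
  refine ⟨⟨φ, fun x => hφ (measurableSet_singleton x), hfin⟩, ?_⟩
  filter_upwards [hM] with ω hω
  rw [abs_le] at hω
  have hval : max (-M) (min M (f ω)) = f ω := by rw [min_eq_right hω.2, max_eq_right hω.1]
  have h1 := Int.floor_le (f ω / ε)
  have h2 := (Int.lt_floor_add_one (f ω / ε)).le
  rw [le_div_iff₀ hε] at h1
  rw [div_le_iff₀ hε] at h2
  have h3 : φ ω = ε * (⌊f ω / ε⌋ : ℤ) := by simp only [φ, hval]
  change |f ω - φ ω| ≤ ε
  rw [h3, abs_le]
  constructor <;> linarith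

/-- The stop-loss transform `E[(X - t)⁺]`. -/
def stopLoss (X : Lp ℝ p μ) (t : ℝ) : ℝ := ∫ ω, max (X ω - t) 0 ∂μ

lemma stopLoss_nonneg (X : Lp ℝ p μ) (t : ℝ) : 0 ≤ stopLoss X t :=
  integral_nonneg fun _ => le_max_right _ _

variable [IsProbabilityMeasure μ]

/-- Law-invariant coherent risk measures on `L^p`: monotone, translation-invariant, sublinear and
law-invariant functionals. -/
structure IsCoherentRisk (ρ : Lp ℝ p μ → ℝ) : Prop where
  mono : ∀ X Y : Lp ℝ p μ, X ≤ Y → ρ X ≤ ρ Y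
  translation : ∀ (X : Lp ℝ p μ) (c : ℝ), ρ (X + Lp.const p μ c) = ρ X + c
  posHom : ∀ (X : Lp ℝ p μ) (t : ℝ), 0 ≤ t → ρ (t • X) = t * ρ X
  subadd : ∀ X Y : Lp ℝ p μ, ρ (X + Y) ≤ ρ X + ρ Y
  lawInv : ∀ X Y : Lp ℝ p μ, IdentDistrib X Y μ μ → ρ X = ρ Y

variable {ρ : Lp ℝ p μ → ℝ}

/-- A simple function as an element of `L^p`. -/
def simpleToLp (p : ℝ≥0∞) (μ : Measure Ω) [IsProbabilityMeasure μ] (f : SimpleFunc Ω ℝ) :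
    Lp ℝ p μ :=
  (f.memLp_of_isFiniteMeasure p μ).toLp f

lemma coeFn_simpleToLp (f : SimpleFunc Ω ℝ) : simpleToLp p μ f =ᵐ[μ] f :=
  MemLp.coeFn_toLp _

lemma IsCoherentRisk.isSimpleRisk (hρ : IsCoherentRisk ρ) :
    IsSimpleRisk μ fun f => ρ (simpleToLp p μ f) where
  mono f g h := hρ.mono _ _ <| (Lp.coeFn_le _ _).1 <| by
    filter_upwards [coeFn_simpleToLp (p := p) (μ := μ) f, coeFn_simpleToLp (p := p) (μ := μ) g]
      with ω h1 h2
    rw [h1, h2]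
    exact h ω
  translation f c := hρ.translation (simpleToLp p μ f) c
  posHom f t ht := hρ.posHom (simpleToLp p μ f) t ht
  subadd f g := hρ.subadd (simpleToLp p μ f) (simpleToLp p μ g)
  lawInv f g h := hρ.lawInv _ _
    ⟨(Lp.aestronglyMeasurable _).aemeasurable, (Lp.aestronglyMeasurable _).aemeasurable, by
      rw [Measure.map_congr (coeFn_simpleToLp f), Measure.map_congr (coeFn_simpleToLp g), h]⟩

lemma norm_const_le (c : ℝ) : ‖Lp.const p μ c‖ ≤ |c| := by
  simpa using Lp.norm_const_le (p := p) (μ := μ) (c := c)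

lemma integral_const_Lp (c : ℝ) : ∫ ω, (Lp.const p μ c : Lp ℝ p μ) ω ∂μ = c := by
  rw [integral_congr_ae (Lp.coeFn_const p μ c)]
  simp

lemma stopLoss_simpleToLp (f : SimpleFunc Ω ℝ) (t : ℝ) :
    stopLoss (simpleToLp p μ f) t = ∫ ω, max (f ω - t) 0 ∂μ :=
  integral_congr_ae <| by
    filter_upwards [coeFn_simpleToLp (p := p) (μ := μ) f] with ω h
    rw [h]

variable [Fact (1 ≤ p)]

lemma Lp_integrable (X : Lp ℝ p μ) : Integrable X μ :=
  (Lp.memLp X).integrable Fact.out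

lemma integral_norm_le_norm (X : Lp ℝ p μ) : ∫ ω, ‖X ω‖ ∂μ ≤ ‖X‖ := by
  rw [integral_norm_eq_lintegral_enorm (Lp.aestronglyMeasurable X), Lp.norm_def,
    ← eLpNorm_one_eq_lintegral_enorm]
  exact ENNReal.toReal_mono (Lp.eLpNorm_ne_top X)
    (eLpNorm_le_eLpNorm_of_exponent_le Fact.out (Lp.aestronglyMeasurable X))

lemma integral_add_Lp (X Y : Lp ℝ p μ) :
    ∫ ω, (X + Y) ω ∂μ = ∫ ω, X ω ∂μ + ∫ ω, Y ω ∂μ := by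
  rw [integral_congr_ae (Lp.coeFn_add X Y)]
  exact integral_add (Lp_integrable X) (Lp_integrable Y)

lemma integral_sub_Lp (X Y : Lp ℝ p μ) :
    ∫ ω, (X - Y) ω ∂μ = ∫ ω, X ω ∂μ - ∫ ω, Y ω ∂μ := by
  rw [integral_congr_ae (Lp.coeFn_sub X Y)]
  exact integral_sub (Lp_integrable X) (Lp_integrable Y)

/-- A monotone sublinear functional on `L^p` is bounded: otherwise one could sum nonnegative
losses of summable norms and unbounded risks. -/
lemma IsCoherentRisk.exists_bound (hρ : IsCoherentRisk ρ) :
    ∃ K : ℝ, 0 ≤ K ∧ ∀ X : Lp ℝ p μ, ρ X ≤ K * ‖X‖ := by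
  by_contra! hcon
  have h0 : ρ 0 = 0 := by simpa using hρ.posHom 0 0 le_rfl
  choose! X hX using fun n : ℕ => hcon (4 ^ n) (by positivity)
  have hX0 : ∀ n, 0 < ‖X n‖ := fun n => by
    rw [norm_pos_iff]
    intro h
    have := hX n
    simp [h, h0] at this
  let Z : ℕ → Lp ℝ p μ := fun n => (1 / (2 ^ n * ‖X n‖)) • |X n|
  have hpos : ∀ n, 0 ≤ 1 / (2 ^ n * ‖X n‖) := fun n => by positivity
  have hZ0 : ∀ n, 0 ≤ Z n := fun n => by
    rw [← Lp.coeFn_nonneg]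
    filter_upwards [Lp.coeFn_smul (1 / (2 ^ n * ‖X n‖)) |X n|, Lp.coeFn_abs (X n)] with ω h1 h2
    simp only [Z, h1, Pi.smul_apply, h2, smul_eq_mul, Pi.zero_apply]
    exact mul_nonneg (hpos n) (abs_nonneg _)
  have hZn : ∀ n, ‖Z n‖ = (1 / 2) ^ n := fun n => by
    have := (hX0 n).ne'
    rw [norm_smul, norm_abs_eq_norm, Real.norm_of_nonneg (hpos n), one_div_pow]
    field_simp
  have hsum : Summable Z := .of_norm <| by
    simp_rw [hZn]
    exact summable_geometric_of_lt_one (by norm_num) (by norm_num)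
  have hlow : ∀ n, (2 : ℝ) ^ n ≤ ρ (∑' n, Z n) := fun n => by
    have h1 : Z n ≤ ∑' n, Z n := hsum.le_tsum n fun m _ => hZ0 m
    refine le_trans ?_ (hρ.mono _ _ h1)
    have h2 : ρ (X n) ≤ ρ |X n| := hρ.mono _ _ (le_abs_self _)
    have h3 : 4 ^ n * ‖X n‖ ≤ ρ |X n| := (hX n).le.trans h2
    rw [hρ.posHom _ _ (hpos n)]
    have h4 : (4 : ℝ) ^ n = 2 ^ n * 2 ^ n := by rw [← mul_pow]; norm_num
    have := (hX0 n).ne'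
    calc (2 : ℝ) ^ n = 1 / (2 ^ n * ‖X n‖) * (4 ^ n * ‖X n‖) := by rw [h4]; field_simp
      _ ≤ _ := mul_le_mul_of_nonneg_left h3 (hpos n)
  obtain ⟨n, hn⟩ := pow_unbounded_of_one_lt (ρ (∑' n, Z n)) (by norm_num : (1 : ℝ) < 2)
  exact absurd (hlow n) (not_le.2 hn)

lemma IsCoherentRisk.exists_lipschitz (hρ : IsCoherentRisk ρ) :
    ∃ K : ℝ, 0 ≤ K ∧ ∀ X Y : Lp ℝ p μ, ρ X ≤ ρ Y + K * ‖X - Y‖ := by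
  obtain ⟨K, hK, hb⟩ := hρ.exists_bound
  refine ⟨K, hK, fun X Y => ?_⟩
  have := hρ.subadd Y (X - Y)
  rw [add_sub_cancel] at this
  linarith [hb (X - Y)]

lemma IsCoherentRisk.continuous (hρ : IsCoherentRisk ρ) : Continuous ρ := by
  obtain ⟨K, hK, hL⟩ := hρ.exists_lipschitz
  refine (LipschitzWith.of_dist_le_mul (K := K.toNNReal) fun X Y => ?_).continuous
  rw [Real.dist_eq, dist_eq_norm, abs_le, Real.coe_toNNReal K hK]
  have h1 := hL X Y
  have h2 := hL Y X
  rw [norm_sub_rev] at h2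
  constructor <;> linarith

/-- Simple functions are dense in `L^p` over a probability space, `p = ∞` included. -/
lemma exists_simpleToLp_near (X : Lp ℝ p μ) {ε : ℝ} (hε : 0 < ε) :
    ∃ f : SimpleFunc Ω ℝ, ‖X - simpleToLp p μ f‖ ≤ ε := by
  by_cases hp : p = ∞
  · subst hp
    have hM : ∀ᵐ ω ∂μ, |X ω| ≤ ‖X‖ := by
      filter_upwards [ae_le_eLpNormEssSup (f := X) (μ := μ)] with ω hω
      rw [Lp.norm_def, eLpNorm_exponent_top, ← Real.norm_eq_abs, ← toReal_enorm]
      exact ENNReal.toReal_mono (eLpNorm_exponent_top (f := X) (μ := μ) ▸ Lp.eLpNorm_ne_top X) hω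
    obtain ⟨g, hg⟩ := exists_simpleFunc_ae_bound (Lp.stronglyMeasurable X).measurable hM hε
    refine ⟨g, ?_⟩
    have : ‖X - simpleToLp ∞ μ g‖ ≤ (measureUnivNNReal μ : ℝ) ^ (∞ : ℝ≥0∞).toReal⁻¹ * ε := by
      refine Lp.norm_le_of_ae_bound hε.le ?_
      filter_upwards [hg, Lp.coeFn_sub X (simpleToLp ∞ μ g), coeFn_simpleToLp (p := ∞) (μ := μ) g]
        with ω h1 h2 h3
      rwa [h2, Pi.sub_apply, h3]
    simpa using this
  · obtain ⟨g, hg, hgm⟩ := (Lp.memLp X).exists_simpleFunc_eLpNorm_sub_lt hp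
      (ENNReal.ofReal_pos.2 hε).ne'
    refine ⟨g, ?_⟩
    rw [Lp.norm_def]
    refine ENNReal.toReal_le_of_le_ofReal hε.le (le_trans (le_of_eq ?_) hg.le)
    refine eLpNorm_congr_ae ?_
    filter_upwards [Lp.coeFn_sub X (simpleToLp p μ g), coeFn_simpleToLp (p := p) (μ := μ) g]
      with ω h2 h3
    rw [h2, Pi.sub_apply, h3, Pi.sub_apply]

lemma integrable_max_sub (X : Lp ℝ p μ) (t : ℝ) : Integrable (fun ω => max (X ω - t) 0) μ :=
  ((Lp_integrable X).sub (integrable_const t)).pos_part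

lemma stopLoss_le_add_norm (X Y : Lp ℝ p μ) (t : ℝ) :
    stopLoss X t ≤ stopLoss Y t + ‖X - Y‖ := by
  refine le_trans ?_ (add_le_add_right (integral_norm_le_norm (X - Y)) _)
  rw [stopLoss, stopLoss, ← integral_add (integrable_max_sub Y t) (Lp_integrable _).norm]
  refine integral_mono_ae (integrable_max_sub X t)
    ((integrable_max_sub Y t).add (Lp_integrable _).norm) ?_
  filter_upwards [Lp.coeFn_sub X Y] with ω h
  simp only [h, Pi.sub_apply, Real.norm_eq_abs]
  refine max_le ?_ (add_nonneg (le_max_right _ _) (abs_nonneg _))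
  linarith [le_max_left (Y ω - t) 0, le_abs_self (X ω - Y ω)]

lemma ae_le_of_stopLoss_eq_zero {X : Lp ℝ p μ} {t : ℝ} (h : stopLoss X t = 0) :
    ∀ᵐ ω ∂μ, X ω ≤ t := by
  have := (integral_eq_zero_iff_of_nonneg (fun _ => le_max_right _ _)
    (integrable_max_sub X t)).1 h
  filter_upwards [this] with ω hω
  have : max (X ω - t) 0 = 0 := hω
  linarith [le_max_left (X ω - t) 0]

lemma SSD.stopLoss_le {X Y : Lp ℝ p μ} (h : SSD X Y) (t : ℝ) :
    stopLoss X t ≤ stopLoss Y t := by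
  refine (h (fun r => max (r - t) 0) (fun a b hab => ?_) ?_ (integrable_max_sub Y t)).2
  · exact max_le_max_right _ (sub_le_sub_right hab t)
  · exact ((convexOn_id convex_univ).sub (concaveOn_const t convex_univ)).sup
      (convexOn_const 0 convex_univ)

/-- A loss can be capped at a level that it exceeds with positive probability, at a small cost in
norm. -/
lemma exists_cap (X : Lp ℝ p μ) {ε : ℝ} (hε : 0 < ε) :
    ∃ c : ℝ, 0 < stopLoss X c ∧ ‖X - X ⊓ Lp.const p μ c‖ ≤ ε := by
  obtain ⟨f, hf⟩ := exists_simpleToLp_near X (half_pos hε)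
  obtain ⟨M, hM⟩ := f.range.bddAbove
  have hfM : ∀ ω, f ω ≤ M := fun ω => hM (f.mem_range_self ω)
  by_cases h : 0 < stopLoss X M
  · refine ⟨M, h, ?_⟩
    have hinf : simpleToLp p μ f ⊓ Lp.const p μ M = simpleToLp p μ f := by
      rw [inf_eq_left, ← Lp.coeFn_le]
      filter_upwards [coeFn_simpleToLp (p := p) (μ := μ) f, Lp.coeFn_const p μ M] with ω h1 h2
      rw [h1, h2]
      exact hfM ω
    have h2 := norm_inf_sub_inf_le_norm (simpleToLp p μ f) X (Lp.const p μ M)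
    rw [hinf, norm_sub_rev _ X] at h2
    calc ‖X - X ⊓ Lp.const p μ M‖ = ‖(X - simpleToLp p μ f) +
          (simpleToLp p μ f - X ⊓ Lp.const p μ M)‖ := by congr 1; abel
      _ ≤ _ := norm_add_le _ _
      _ ≤ ε := by linarith
  · have hM0 : stopLoss X M = 0 := le_antisymm (not_lt.1 h) (stopLoss_nonneg X M)
    have hXM := ae_le_of_stopLoss_eq_zero hM0
    let S : Set ℝ := {c | 0 < stopLoss X c}
    have hne : S.Nonempty := by
      refine ⟨∫ ω, X ω ∂μ - 1, ?_⟩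
      have h1 : ∫ ω, (X ω - (∫ ω, X ω ∂μ - 1)) ∂μ ≤ stopLoss X (∫ ω, X ω ∂μ - 1) :=
        integral_mono ((Lp_integrable X).sub (integrable_const _)) (integrable_max_sub X _)
          fun _ => le_max_left _ _
      rw [integral_sub (Lp_integrable X) (integrable_const _)] at h1
      simp only [integral_const, probReal_univ, one_smul] at h1
      change 0 < stopLoss X _
      linarith
    have hbdd : BddAbove S := by
      refine ⟨M, fun c hc => ?_⟩
      by_contra! hlt
      have : stopLoss X c = 0 := by
        refine integral_eq_zero_of_ae ?_
        filter_upwards [hXM] with ω hω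
        exact max_eq_right (sub_nonpos.2 (hω.trans hlt.le))
      exact absurd hc (by simp [S, this])
    obtain ⟨c, hc, hlt⟩ := exists_lt_of_lt_csSup hne (sub_lt_self (sSup S) hε)
    refine ⟨c, hc, ?_⟩
    have h0 : stopLoss X (c + ε) = 0 := by
      by_contra hne0
      have : c + ε ∈ S := lt_of_le_of_ne (stopLoss_nonneg X _) (Ne.symm hne0)
      linarith [le_csSup hbdd this]
    have hXc := ae_le_of_stopLoss_eq_zero h0
    refine le_trans ?_ ((norm_const_le (p := p) (μ := μ) ε).trans_eq (abs_of_pos hε))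
    refine Lp.norm_le_norm_of_ae_le ?_
    filter_upwards [hXc, Lp.coeFn_sub X (X ⊓ Lp.const p μ c), Lp.coeFn_inf X (Lp.const p μ c),
      Lp.coeFn_const p μ c, Lp.coeFn_const p μ ε] with ω h1 h2 h3 h4 h5
    rw [h2, Pi.sub_apply, h3, Pi.inf_apply, h4, h5, Function.const_apply, Function.const_apply,
      Real.norm_eq_abs, Real.norm_eq_abs, abs_of_pos hε, abs_le]
    rcases le_total (X ω) c with h | h
    · rw [inf_eq_left.2 h]; constructor <;> linarith
    · rw [inf_eq_right.2 h]; constructor <;> linarith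

/-- A law-invariant coherent risk measure on `L^p` over a nonatomic space is monotone in the
increasing convex order. For simple losses this is `IsSimpleRisk.le_of_stopLoss`. In general,
capping `X` slightly lowers its stop-loss transform by a constant below the cap, which leaves
room for replacing both losses by simple approximations. -/
theorem IsCoherentRisk.le_of_SSD (hρ : IsCoherentRisk ρ) (hμ : Nonatomic μ) {X Y : Lp ℝ p μ}
    (h : SSD X Y) : ρ X ≤ ρ Y := by
  obtain ⟨K, hK, hL⟩ := hρ.exists_lipschitz
  have key : ∀ ε > 0, ρ X ≤ ρ Y + 3 * K * ε := by
    intro ε hε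
    obtain ⟨c, hc, hcap⟩ := exists_cap X hε
    let δ := stopLoss X c / 3
    have hδ : 0 < δ := by positivity
    obtain ⟨f, hf⟩ := exists_simpleToLp_near X (lt_min hδ hε)
    obtain ⟨g, hg⟩ := exists_simpleToLp_near Y (lt_min hδ hε)
    let f' : SimpleFunc Ω ℝ := f.map fun r => min r c
    have hcoe : simpleToLp p μ f' = simpleToLp p μ f ⊓ Lp.const p μ c := by
      apply Lp.ext
      filter_upwards [coeFn_simpleToLp (p := p) (μ := μ) f, coeFn_simpleToLp (p := p) (μ := μ) f',
        Lp.coeFn_inf (simpleToLp p μ f) (Lp.const p μ c), Lp.coeFn_const p μ c] with ω h1 h2 h3 h4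
      rw [h2, h3, Pi.inf_apply, h1, h4]
      rfl
    have hsl : ∀ t : ℝ, ∫ ω, max (f' ω - t) 0 ∂μ ≤ ∫ ω, max (g ω - t) 0 ∂μ := by
      intro t
      rcases le_total c t with hct | htc
      · have h0 : ∀ ω, max (f' ω - t) 0 = 0 := fun ω =>
          max_eq_right (by simpa [f'] using Or.inr hct)
        simp only [h0, integral_zero]
        exact integral_nonneg fun _ => le_max_right _ _
      · have h0 : ∀ ω, max (f' ω - t) 0 = max (f ω - t) 0 - max (f ω - c) 0 := fun ω => by
          simp only [f', SimpleFunc.map_apply]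
          rcases le_total (f ω) c with h | h
          · rw [min_eq_left h, max_eq_right (sub_nonpos.2 h), sub_zero]
          · rw [min_eq_right h, max_eq_left (sub_nonneg.2 h), max_eq_left (sub_nonneg.2 htc),
              max_eq_left (sub_nonneg.2 (htc.trans h))]
            ring
        simp only [h0]
        rw [integral_sub (SimpleFunc.integrable_max_sub f t) (SimpleFunc.integrable_max_sub f c),
          ← stopLoss_simpleToLp (p := p), ← stopLoss_simpleToLp (p := p),
          ← stopLoss_simpleToLp (p := p)]
        have h1 := stopLoss_le_add_norm (simpleToLp p μ f) X t
        have h2 := stopLoss_le_add_norm X (simpleToLp p μ f) c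
        have h3 := stopLoss_le_add_norm Y (simpleToLp p μ g) t
        rw [norm_sub_rev] at h1
        have h4 := h.stopLoss_le t
        have h5 := hf.trans (min_le_left _ _)
        have h6 := hg.trans (min_le_left _ _)
        have h7 : stopLoss X c = 3 * δ := by simp only [δ]; ring
        linarith
    have hfg : ρ (simpleToLp p μ f') ≤ ρ (simpleToLp p μ g) :=
      hρ.isSimpleRisk.le_of_stopLoss hμ f' g hsl
    have hXf : ‖X - simpleToLp p μ f'‖ ≤ 2 * ε := by
      rw [hcoe]
      have h2 := norm_inf_sub_inf_le_norm X (simpleToLp p μ f) (Lp.const p μ c)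
      have h3 := hf.trans (min_le_right _ _)
      calc _ = ‖(X - X ⊓ Lp.const p μ c) +
            (X ⊓ Lp.const p μ c - simpleToLp p μ f ⊓ Lp.const p μ c)‖ := by congr 1; abel
        _ ≤ _ := norm_add_le _ _
        _ ≤ 2 * ε := by linarith
    have hgY : ‖simpleToLp p μ g - Y‖ ≤ ε := by
      rw [norm_sub_rev]
      exact hg.trans (min_le_right _ _)
    have h1 := hL X (simpleToLp p μ f')
    have h2 := hL (simpleToLp p μ g) Y
    have h3 := mul_le_mul_of_nonneg_left hXf hK
    have h4 := mul_le_mul_of_nonneg_left hgY hK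
    linarith
  by_contra! hlt
  have := key ((ρ X - ρ Y) / (3 * K + 1)) (div_pos (sub_pos.2 hlt) (by positivity))
  have h1 : (3 * K + 1) * ((ρ X - ρ Y) / (3 * K + 1)) = ρ X - ρ Y := by field_simp
  have h2 : 0 < (ρ X - ρ Y) / (3 * K + 1) := div_pos (sub_pos.2 hlt) (by positivity)
  linarith

end LpRisk

/-! ### Mean-deviation functionals satisfy the axioms -/

section RangeNormalized

variable {Ω : Type*} [MeasurableSpace Ω] {μ : Measure Ω} {p : ℝ≥0∞}

lemma essSup_le_coe_iff (X : Lp ℝ p μ) (r : ℝ) :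
    essSup (fun ω => ((X ω : ℝ) : EReal)) μ ≤ r ↔ ∀ᵐ ω ∂μ, X ω ≤ r := by
  constructor
  · intro h
    filter_upwards [ae_le_essSup (f := fun ω => ((X ω : ℝ) : EReal)) (μ := μ)] with ω hω
    exact EReal.coe_le_coe_iff.1 (hω.trans h)
  · intro h
    refine essSup_le_of_ae_le _ ?_
    filter_upwards [h] with ω hω
    exact EReal.coe_le_coe_iff.2 hω

variable [IsProbabilityMeasure μ]

lemma essSup_coe_ne_bot (X : Lp ℝ p μ) : essSup (fun ω => ((X ω : ℝ) : EReal)) μ ≠ ⊥ := by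
  intro h
  have : ∀ᵐ ω ∂μ, False := by
    filter_upwards [ae_le_essSup (f := fun ω => ((X ω : ℝ) : EReal)) (μ := μ)] with ω hω
    rw [h] at hω
    exact EReal.coe_ne_bot _ (le_bot_iff.1 hω)
  exact this.exists.elim fun _ h => h

/-- Either the essential supremum is infinite and the range ratio vanishes, or it is a real
number and the range ratio is a quotient of real numbers. -/
lemma rangeRatio_cases (D : Lp ℝ p μ → ℝ≥0) (X : Lp ℝ p μ) :
    (essSup (fun ω => ((X ω : ℝ) : EReal)) μ = ⊤ ∧ rangeRatio D X = 0) ∨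
      ∃ r : ℝ, essSup (fun ω => ((X ω : ℝ) : EReal)) μ = r ∧ (∀ᵐ ω ∂μ, X ω ≤ r) ∧
        rangeRatio D X = ((D X / (r - ∫ ω, X ω ∂μ) : ℝ) : EReal) := by
  induction h : essSup (fun ω => ((X ω : ℝ) : EReal)) μ with
  | bot => exact absurd h (essSup_coe_ne_bot X)
  | top =>
    left
    refine ⟨rfl, ?_⟩
    rw [rangeRatio, h, EReal.top_sub_coe, EReal.div_top]
  | coe r =>
    right
    refine ⟨r, rfl, (essSup_le_coe_iff X r).1 h.le, ?_⟩
    rw [rangeRatio, h, EReal.coe_div, EReal.coe_sub]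

lemma IsDeviation.zero {D : Lp ℝ p μ → ℝ≥0} (hD : IsDeviation D) : D 0 = 0 := by
  simpa using hD.posHom 0 0

lemma IsDeviation.const {D : Lp ℝ p μ → ℝ≥0} (hD : IsDeviation D) (c : ℝ) :
    D (Lp.const p μ c) = 0 := by
  simpa [hD.zero] using hD.translation 0 c

lemma IsDeviation.coe_smul {D : Lp ℝ p μ → ℝ≥0} (hD : IsDeviation D) (X : Lp ℝ p μ) {t : ℝ}
    (ht : 0 ≤ t) : (D (t • X) : ℝ) = t * D X := by
  lift t to ℝ≥0 using ht
  rw [hD.posHom, NNReal.coe_mul]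

variable [Fact (1 ≤ p)]

lemma Nonconst.integral_lt {X : Lp ℝ p μ} (hX : Nonconst X) {r : ℝ} (h : ∀ᵐ ω ∂μ, X ω ≤ r) :
    ∫ ω, X ω ∂μ < r := by
  have hi : Integrable (fun ω => r - X ω) μ := (integrable_const r).sub (Lp_integrable X)
  have hnn : 0 ≤ᵐ[μ] fun ω => r - X ω := by
    filter_upwards [h] with ω hω
    exact sub_nonneg.2 hω
  have heq : ∫ ω, (r - X ω) ∂μ = r - ∫ ω, X ω ∂μ := by
    rw [integral_sub (integrable_const r) (Lp_integrable X)]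
    simp
  have hge := integral_nonneg_of_ae hnn
  rw [heq] at hge
  refine lt_of_le_of_ne (sub_nonneg.1 hge) fun hr => hX ⟨r, Lp.ext ?_⟩
  have h0 := (integral_eq_zero_iff_of_nonneg_ae hnn hi).1 (by rw [heq, hr, sub_self])
  filter_upwards [h0, Lp.coeFn_const p μ r] with ω h1 h2
  rw [h2]
  exact (sub_eq_zero.1 h1).symm

/-- Range normalization bounds the deviation by the distance from the mean to any essential upper
bound. -/
lemma IsRangeNormalized.le_sub {D : Lp ℝ p μ → ℝ≥0} (hD : IsRangeNormalized D) {X : Lp ℝ p μ}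
    {m : ℝ} (hm : ∀ᵐ ω ∂μ, X ω ≤ m) : (D X : ℝ) ≤ m - ∫ ω, X ω ∂μ := by
  by_cases hX : Nonconst X
  · have hle : rangeRatio D X ≤ 1 := hD.sup_eq_one ▸ le_sSup ⟨X, hX, rfl⟩
    have hsup := (essSup_le_coe_iff X m).2 hm
    rcases rangeRatio_cases D X with ⟨h, -⟩ | ⟨r, h, hr, hq⟩
    · rw [h] at hsup
      exact absurd hsup (by simp)
    · rw [h, EReal.coe_le_coe_iff] at hsup
      rw [hq, ← EReal.coe_one, EReal.coe_le_coe_iff,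
        div_le_one (sub_pos.2 (hX.integral_lt hr))] at hle
      linarith
  · obtain ⟨c, rfl⟩ := not_not.1 hX
    have : ∀ᵐ ω ∂μ, c ≤ m := by
      filter_upwards [hm, Lp.coeFn_const p μ c] with ω h1 h2
      rw [h2] at h1
      exact h1
    have hcm : c ≤ m := by simpa using this
    rw [hD.isDeviation.const, integral_const_Lp]
    simpa using hcm

/-- Adding the mean to a range-normalized deviation gives a coherent risk measure; range
normalization is what makes the sum monotone. -/
lemma IsRangeNormalized.isCoherentRisk {D : Lp ℝ p μ → ℝ≥0} (hD : IsRangeNormalized D) :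
    IsCoherentRisk fun X => (D X : ℝ) + ∫ ω, X ω ∂μ where
  mono X Y h := by
    have h1 : ∀ᵐ ω ∂μ, (X - Y) ω ≤ 0 := by
      filter_upwards [(Lp.coeFn_le X Y).2 h, Lp.coeFn_sub X Y] with ω h1 h2
      rw [h2]
      exact sub_nonpos.2 h1
    have h2 := hD.le_sub h1
    have h3 : (D X : ℝ) ≤ D Y + D (X - Y) := by
      have := hD.isDeviation.subadd Y (X - Y)
      rw [add_sub_cancel] at this
      exact_mod_cast this
    rw [integral_sub_Lp] at h2
    linarith
  translation X c := by
    rw [hD.isDeviation.translation, integral_add_Lp, integral_const_Lp]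
    ring
  posHom X t ht := by
    rw [hD.isDeviation.coe_smul X ht, integral_smul_Lp]
    ring
  subadd X Y := by
    have : (D (X + Y) : ℝ) ≤ D X + D Y := by exact_mod_cast hD.isDeviation.subadd X Y
    rw [integral_add_Lp]
    linarith
  lawInv X Y h := by
    rw [hD.isDeviation.lawInv X Y h, h.integral_eq]

lemma continuous_integral_Lp : Continuous fun X : Lp ℝ p μ => ∫ ω, X ω ∂μ := by
  refine (LipschitzWith.of_dist_le_mul (K := 1) fun X Y => ?_).continuous
  rw [Real.dist_eq, dist_eq_norm, NNReal.coe_one, one_mul, ← integral_sub_Lp]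
  exact (norm_integral_le_integral_norm _).trans (integral_norm_le_norm _)

lemma IsRangeNormalized.continuous {D : Lp ℝ p μ → ℝ≥0} (hD : IsRangeNormalized D) :
    Continuous D := by
  have h : Continuous fun X => (D X : ℝ) := by
    simpa [Pi.sub_def] using hD.isCoherentRisk.continuous.sub continuous_integral_Lp
  simpa [Function.comp_def] using continuous_real_toNNReal.comp h

/-- A mean-deviation functional with strictly increasing weight satisfies the axioms. Since `g` is
1-Lipschitz, it inherits monotonicity from `D + E`; consistency with the convex order and continuity
also come from that coherent risk measure. -/
theorem Axioms.of_represents (hμ : Nonatomic μ) {R : Lp ℝ p μ → Lp ℝ p μ → Prop}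
    {D : Lp ℝ p μ → ℝ≥0} {g : ℝ≥0 → ℝ} (hD : IsRangeNormalized D) (hg : IsRiskWeighting g)
    (hgs : StrictMono g) (hrep : Represents (MD g D) R) : Axioms R where
  A1 X Y h := by
    rw [hrep]
    have h1 : (D X : ℝ) + ∫ ω, X ω ∂μ ≤ D Y + ∫ ω, Y ω ∂μ := hD.isCoherentRisk.mono X Y h
    have hE : ∫ ω, X ω ∂μ ≤ ∫ ω, Y ω ∂μ :=
      integral_mono_ae (Lp_integrable X) (Lp_integrable Y) ((Lp.coeFn_le X Y).2 h)
    simp only [MD]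
    rcases le_total (D X) (D Y) with h2 | h2
    · linarith [hg.mono h2]
    · have h3 := hg.lipschitz.dist_le_mul (D X) (D Y)
      rw [NNReal.coe_one, one_mul, Real.dist_eq, NNReal.dist_eq,
        abs_of_nonneg (sub_nonneg.2 (NNReal.coe_le_coe.2 h2))] at h3
      linarith [le_abs_self (g (D X) - g (D Y))]
  A2 X Y c := by
    rw [hrep, hrep]
    simp only [MD, hD.isDeviation.translation, integral_add_Lp]
    constructor <;> intro h <;> linarith
  A3 X Y hE h t ht := by
    rw [hrep] at h ⊢
    simp only [MD, integral_smul_Lp, hE, add_le_add_iff_right, hgs.le_iff_le] at h ⊢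
    rw [← NNReal.coe_le_coe, hD.isDeviation.coe_smul X ht.le, hD.isDeviation.coe_smul Y ht.le]
    exact mul_le_mul_of_nonneg_left (NNReal.coe_le_coe.2 h) ht.le
  A4_convexOrder X Y h := by
    rw [hrep]
    have h1 : (D X : ℝ) + ∫ ω, X ω ∂μ ≤ D Y + ∫ ω, Y ω ∂μ :=
      hD.isCoherentRisk.le_of_SSD hμ h.1
    rw [h.2, add_le_add_iff_right, NNReal.coe_le_coe] at h1
    simp only [MD, h.2, add_le_add_iff_right]
    exact hg.mono h1
  A4_strict X hX := by
    have h1 : g 0 < g (D X) := hgs (hD.isDeviation.pos X hX)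
    rw [StrictPart, hrep, hrep]
    simp only [MD, hD.isDeviation.const, integral_const_Lp]
    constructor
    · linarith
    · push Not
      linarith
  A5 X := by
    refine ⟨MD g D X, ?_⟩
    have : MD g D (Lp.const p μ (MD g D X)) = MD g D X := by
      rw [MD, hD.isDeviation.const, integral_const_Lp, hg.zero, zero_add]
    rw [Indiff, hrep, hrep, this]
    exact ⟨le_rfl, le_rfl⟩
  A6 X Y hE hXY t ht0 ht1 := by
    rw [Indiff, hrep, hrep] at hXY
    simp only [MD, hE, add_le_add_iff_right, hgs.le_iff_le] at hXY
    have hDXY : D X = D Y := le_antisymm hXY.1 hXY.2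
    rw [hrep]
    have h3 : D (t • X + (1 - t) • Y) ≤ D X := by
      have h := NNReal.coe_le_coe.2 (hD.isDeviation.subadd (t • X) ((1 - t) • Y))
      rw [NNReal.coe_add, hD.isDeviation.coe_smul X ht0,
        hD.isDeviation.coe_smul Y (sub_nonneg.2 ht1), ← hDXY] at h
      rw [← NNReal.coe_le_coe]
      linarith
    have h4 : ∫ ω, (t • X + (1 - t) • Y) ω ∂μ = ∫ ω, X ω ∂μ := by
      rw [integral_add_Lp, integral_smul_Lp, integral_smul_Lp, hE]
      ring
    simp only [MD, h4, add_le_add_iff_right]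
    exact hg.mono h3
  A7 X := by
    have hc : Continuous (MD g D) :=
      (hg.lipschitz.continuous.comp hD.continuous).add continuous_integral_Lp
    simp only [hrep _ _]
    exact ⟨isClosed_le hc continuous_const, isClosed_le continuous_const hc⟩

end RangeNormalized

/-! ### The certainty equivalent of a preference relation -/

section CertaintyEquivalent

variable {Ω : Type*} [MeasurableSpace Ω] {μ : Measure Ω} {p : ℝ≥0∞}

/-- Equally distributed losses are ordered both ways in the convex order. -/
lemma convexOrder_of_identDistrib {X Y : Lp ℝ p μ} (h : IdentDistrib X Y μ μ) :
    ConvexOrder X Y := by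
  refine ⟨fun u hu _ hi => ?_, h.integral_eq⟩
  have h' := h.comp hu.measurable
  exact ⟨h'.integrable_iff.2 hi, h'.integral_eq.le⟩

variable [IsProbabilityMeasure μ]

lemma const_le_const {c d : ℝ} (h : c ≤ d) : Lp.const p μ c ≤ Lp.const p μ d := by
  rw [← Lp.coeFn_le]
  filter_upwards [Lp.coeFn_const p μ c, Lp.coeFn_const p μ d] with ω h1 h2
  rw [h1, h2]
  exact h

lemma nonconst_smul {X : Lp ℝ p μ} (hX : Nonconst X) {t : ℝ} (ht : t ≠ 0) : Nonconst (t • X) := by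
  rintro ⟨c, hc⟩
  refine hX ⟨t⁻¹ * c, ?_⟩
  have h1 : X = t⁻¹ • Lp.const p μ c := by rw [← hc, inv_smul_smul₀ ht]
  rw [h1]
  exact ((Lp.constₗ p μ ℝ).map_smul t⁻¹ c).symm

/-- A nonatomic space carries a nonconstant centered loss bounded above by `1`. -/
lemma Nonatomic.exists_nonconst (hμ : Nonatomic μ) (p : ℝ≥0∞) :
    ∃ X : Lp ℝ p μ, Nonconst X ∧ ∫ ω, X ω ∂μ = 0 ∧ X ≤ Lp.const p μ 1 := by
  obtain ⟨B, hB, -, hB0, hB1⟩ := hμ Set.univ .univ (by simp)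
  rw [measure_univ] at hB1
  let f : SimpleFunc Ω ℝ :=
    SimpleFunc.piecewise B hB (.const Ω (1 - μ.real B)) (.const Ω (-μ.real B))
  have hf : ∀ ω, f ω = B.indicator (fun _ => (1 : ℝ)) ω - μ.real B := fun ω => by
    by_cases h : ω ∈ B <;> simp [f, h]
  have hX := coeFn_simpleToLp (p := p) (μ := μ) f
  refine ⟨simpleToLp p μ f, ?_, ?_, ?_⟩
  · rintro ⟨c, hc⟩
    have hae : ∀ᵐ ω ∂μ, f ω = c := by
      filter_upwards [hX, Lp.coeFn_const p μ c] with ω h1 h2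
      rw [← h1, hc, h2]
      rfl
    have h1 : ∃ ω ∈ B, f ω = c := by
      by_contra! h
      exact hB0.ne' (measure_mono_null (fun ω hω => h ω hω) hae)
    have h2 : ∃ ω ∈ Bᶜ, f ω = c := by
      by_contra! h
      have h0 : μ Bᶜ = 0 := measure_mono_null (fun ω hω => h ω hω) hae
      rw [prob_compl_eq_zero_iff hB] at h0
      exact hB1.ne h0
    obtain ⟨a, ha, hfa⟩ := h1
    obtain ⟨b, hb, hfb⟩ := h2
    rw [hf, Set.indicator_of_mem ha] at hfa
    rw [hf, Set.indicator_of_notMem hb] at hfb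
    linarith
  · rw [integral_congr_ae hX]
    simp_rw [hf]
    rw [integral_sub ((integrable_const _).indicator hB) (integrable_const _),
      integral_indicator_const _ hB]
    simp
  · rw [← Lp.coeFn_le]
    filter_upwards [hX, Lp.coeFn_const p μ (1 : ℝ)] with ω h1 h2
    rw [h1, h2, hf]
    have h3 : B.indicator (fun _ => (1 : ℝ)) ω ≤ 1 :=
      Set.indicator_le_self' (fun _ _ => zero_le_one) ω
    have h4 : 0 ≤ μ.real B := measureReal_nonneg
    change _ ≤ (1 : ℝ)
    linarith

variable [Fact (1 ≤ p)]

/-- The axioms, expressed for the certainty equivalent `ρ`, where `ρ X` is the constant indifferent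
to `X`. -/
structure IsCertaintyEquivalent (ρ : Lp ℝ p μ → ℝ) : Prop where
  mono : ∀ X Y : Lp ℝ p μ, X ≤ Y → ρ X ≤ ρ Y
  translation : ∀ (X : Lp ℝ p μ) (c : ℝ), ρ (X + Lp.const p μ c) = ρ X + c
  zero : ρ 0 = 0
  homog : ∀ X Y : Lp ℝ p μ, ∫ ω, X ω ∂μ = ∫ ω, Y ω ∂μ → ρ X ≤ ρ Y →
    ∀ t : ℝ, 0 < t → ρ (t • X) ≤ ρ (t • Y)
  lawInv : ∀ X Y : Lp ℝ p μ, IdentDistrib X Y μ μ → ρ X = ρ Y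
  integral_lt : ∀ X : Lp ℝ p μ, Nonconst X → ∫ ω, X ω ∂μ < ρ X
  quasiconvex : ∀ X Y : Lp ℝ p μ, ∫ ω, X ω ∂μ = ∫ ω, Y ω ∂μ → ρ X = ρ Y →
    ∀ t : ℝ, 0 ≤ t → t ≤ 1 → ρ (t • X + (1 - t) • Y) ≤ ρ X
  continuous : Continuous ρ

section

variable {R : Lp ℝ p μ → Lp ℝ p μ → Prop}

/-- Smaller sure losses are strictly preferred. Otherwise, by translation invariance, all constants
would be equivalent and a bounded nonconstant loss would be as good as its mean. -/
lemma Axioms.not_rel_const (hA : Axioms R) (hR : IsPreference R) (hμ : Nonatomic μ) {c d : ℝ}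
    (hcd : c < d) : ¬ R (Lp.const p μ d) (Lp.const p μ c) := by
  intro h
  have hstep : ∀ a : ℝ, R (Lp.const p μ (a + (d - c))) (Lp.const p μ a) := fun a => by
    have := (hA.A2 _ _ (a - c)).1 h
    rw [← map_add, ← map_add] at this
    convert this using 2 <;> ring
  have hn : ∀ n : ℕ, R (Lp.const p μ (n * (d - c))) (Lp.const p μ 0) := by
    intro n
    induction n with
    | zero => simpa using hR.refl _
    | succ n ih =>
      refine hR.trans _ _ _ ?_ ih
      have := hstep (n * (d - c))
      convert this using 2
      push_cast
      ring
  obtain ⟨X, hX, hX0, hX1⟩ := hμ.exists_nonconst p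
  obtain ⟨n, hn1⟩ := Archimedean.arch 1 (sub_pos.2 hcd)
  rw [nsmul_eq_mul] at hn1
  have h1 : X ≤ Lp.const p μ (n * (d - c)) := hX1.trans (const_le_const hn1)
  have h2 := (hA.A4_strict X hX).2
  rw [hX0] at h2
  exact h2 (hR.trans _ _ _ (hA.A1 _ _ h1) (hn n))

/-- A relation satisfying the axioms is represented by its certainty equivalent. -/
lemma Axioms.exists_certaintyEquivalent (hA : Axioms R) (hR : IsPreference R)
    (hμ : Nonatomic μ) :
    ∃ ρ : Lp ℝ p μ → ℝ, IsCertaintyEquivalent ρ ∧ Represents ρ R := by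
  choose ρ hρ using hA.A5
  have hconst : ∀ c d : ℝ, R (Lp.const p μ c) (Lp.const p μ d) ↔ c ≤ d := fun c d => by
    constructor
    · intro h
      by_contra! hlt
      exact hA.not_rel_const hR hμ hlt h
    · intro h
      exact hA.A1 _ _ (const_le_const h)
  have hrep : Represents ρ R := fun X Y => by
    rw [← hconst]
    exact ⟨fun h => hR.trans _ _ _ (hρ X).2 (hR.trans _ _ _ h (hρ Y).1),
      fun h => hR.trans _ _ _ (hρ X).1 (hR.trans _ _ _ h (hρ Y).2)⟩
  have heq : ∀ X Y, Indiff R X Y → ρ X = ρ Y := fun X Y h =>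
    le_antisymm ((hrep _ _).1 h.1) ((hrep _ _).1 h.2)
  have hρc : ∀ c : ℝ, ρ (Lp.const p μ c) = c := fun c =>
    le_antisymm ((hconst _ _).1 (hρ (Lp.const p μ c)).2) ((hconst _ _).1 (hρ (Lp.const p μ c)).1)
  refine ⟨ρ, ⟨fun X Y h => (hrep _ _).1 (hA.A1 X Y h), fun X c => ?_, ?_, fun X Y hE h t ht => ?_,
    fun X Y h => ?_, fun X hX => ?_, fun X Y hE h t h0 h1 => ?_, ?_⟩, hrep⟩
  · have h1 : Indiff R (X + Lp.const p μ c) (Lp.const p μ (ρ X + c)) := by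
      rw [map_add]
      exact ⟨(hA.A2 _ _ c).1 (hρ X).1, (hA.A2 _ _ c).1 (hρ X).2⟩
    rw [heq _ _ h1, hρc]
  · simpa using hρc 0
  · exact (hrep _ _).1 (hA.A3 X Y hE ((hrep _ _).2 h) t ht)
  · exact le_antisymm ((hrep _ _).1 (hA.A4_convexOrder _ _ (convexOrder_of_identDistrib h)))
      ((hrep _ _).1 (hA.A4_convexOrder _ _ (convexOrder_of_identDistrib h.symm)))
  · have := (hA.A4_strict X hX).2
    rwa [hrep, not_le, hρc] at this
  · exact (hrep _ _).1 (hA.A6 X Y hE ⟨(hrep _ _).2 h.le, (hrep _ _).2 h.ge⟩ t h0 h1)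
  · rw [continuous_iff_lower_upperSemicontinuous, lowerSemicontinuous_iff_isClosed_preimage,
      upperSemicontinuous_iff_isClosed_preimage]
    constructor <;> intro c
    · have := (hA.A7 (Lp.const p μ c)).1
      simp only [hrep _ _, hρc] at this
      exact this
    · have := (hA.A7 (Lp.const p μ c)).2
      simp only [hrep _ _, hρc] at this
      exact this

end

variable {ρ : Lp ℝ p μ → ℝ}

/-- Along a ray of centered losses the certainty equivalent is strictly increasing: if
`ρ (t • X) ≤ ρ (s • X)` for some `s < t`, rescaling by powers of `s / t` would give
`ρ (t • X) ≤ ρ 0`. -/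
lemma IsCertaintyEquivalent.strictMonoOn_ray (hρ : IsCertaintyEquivalent ρ) {X : Lp ℝ p μ}
    (hX : Nonconst X) (hE : ∫ ω, X ω ∂μ = 0) {s t : ℝ} (hs : 0 ≤ s) (hst : s < t) :
    ρ (s • X) < ρ (t • X) := by
  have ht : 0 < t := hs.trans_lt hst
  have hpos : 0 < ρ (t • X) := by
    have := hρ.integral_lt (t • X) (nonconst_smul hX ht.ne')
    rwa [integral_smul_Lp, hE, mul_zero] at this
  by_contra! h
  rcases hs.eq_or_lt with rfl | hs
  · rw [zero_smul, hρ.zero] at h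
    linarith
  let r := s / t
  have hr0 : 0 < r := div_pos hs ht
  have hr1 : r < 1 := (div_lt_one ht).2 hst
  have hn : ∀ n : ℕ, ρ (t • X) ≤ ρ ((r ^ n * t) • X) := by
    intro n
    induction n with
    | zero => simp
    | succ n ih =>
      refine ih.trans ?_
      have := hρ.homog (t • X) (s • X) (by simp [integral_smul_Lp, hE]) h (r ^ n) (pow_pos hr0 n)
      have hrs : r ^ n * s = r ^ (n + 1) * t := by
        simp only [r, pow_succ]
        field_simp
      rwa [smul_smul, smul_smul, hrs] at this
  have hlim : Filter.Tendsto (fun n : ℕ => ρ ((r ^ n * t) • X)) Filter.atTop (nhds (ρ 0)) := by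
    refine (hρ.continuous.tendsto 0).comp ?_
    have h1 := ((tendsto_pow_atTop_nhds_zero_of_lt_one hr0.le hr1).mul_const t).smul_const X
    simpa using h1
  have := ge_of_tendsto' hlim hn
  rw [hρ.zero] at this
  linarith

lemma IsCertaintyEquivalent.ray_le_iff (hρ : IsCertaintyEquivalent ρ) {X : Lp ℝ p μ}
    (hX : Nonconst X) (hE : ∫ ω, X ω ∂μ = 0) {s t : ℝ} (hs : 0 ≤ s) (ht : 0 ≤ t) :
    ρ (s • X) ≤ ρ (t • X) ↔ s ≤ t := by
  constructor
  · intro h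
    by_contra! hlt
    exact absurd h (not_le.2 (hρ.strictMonoOn_ray hX hE ht hlt))
  · intro h
    rcases h.eq_or_lt with rfl | h
    · exact le_rfl
    · exact (hρ.strictMonoOn_ray hX hE hs h).le

/-- Every centered loss is equivalent to a multiple of a given nonconstant centered loss. -/
lemma IsCertaintyEquivalent.exists_ray_eq (hρ : IsCertaintyEquivalent ρ) {X Z : Lp ℝ p μ}
    (hX : Nonconst X) (hE : ∫ ω, X ω ∂μ = 0) (hZ : ∫ ω, Z ω ∂μ = 0) :
    ∃ t : ℝ≥0, ρ Z = ρ ((t : ℝ) • X) := by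
  have hZ0 : 0 ≤ ρ Z := by
    by_cases h : Nonconst Z
    · exact hZ ▸ (hρ.integral_lt Z h).le
    · obtain ⟨c, rfl⟩ := not_not.1 h
      rw [integral_const_Lp] at hZ
      simp [hZ, hρ.zero]
  have hX0 : 0 < ρ X := hE ▸ hρ.integral_lt X hX
  obtain ⟨T, hT0, hT⟩ : ∃ T : ℝ, 0 ≤ T ∧ ρ Z ≤ ρ (T • X) := by
    by_contra! h
    -- Otherwise `ρ X ≤ ρ (T⁻¹ • Z)` for all `T`, and the right-hand side tends to `ρ 0`.
    have h1 : ∀ n : ℕ, ρ X ≤ ρ ((1 / ((n : ℝ) + 1)) • Z) := fun n => by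
      have hn : (0 : ℝ) < (n : ℝ) + 1 := by positivity
      have := hρ.homog _ Z (by rw [integral_smul_Lp, hE, hZ, mul_zero]) (h _ hn.le).le
        (1 / ((n : ℝ) + 1)) (by positivity)
      rwa [smul_smul, one_div_mul_cancel hn.ne', one_smul] at this
    have hlim : Filter.Tendsto (fun n : ℕ => ρ ((1 / ((n : ℝ) + 1)) • Z)) Filter.atTop
        (nhds (ρ 0)) := by
      refine (hρ.continuous.tendsto 0).comp ?_
      simpa using (tendsto_one_div_add_atTop_nhds_zero_nat (𝕜 := ℝ)).smul_const Z
    have := ge_of_tendsto' hlim h1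
    rw [hρ.zero] at this
    linarith
  have hc : ContinuousOn (fun t : ℝ => ρ (t • X)) (Set.Icc 0 T) :=
    (hρ.continuous.comp (by fun_prop : Continuous fun t : ℝ => t • X)).continuousOn
  obtain ⟨t, ht, hte⟩ := intermediate_value_Icc hT0 hc
    (show ρ Z ∈ Set.Icc (ρ ((0 : ℝ) • X)) (ρ (T • X)) from ⟨by simpa [hρ.zero] using hZ0, hT⟩)
  exact ⟨⟨t, ht.1⟩, hte.symm⟩

end CertaintyEquivalent

/-! ### Centered losses -/

section Center

variable {Ω : Type*} [MeasurableSpace Ω] {μ : Measure Ω} [IsProbabilityMeasure μ] {p : ℝ≥0∞}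

/-- The centered version `X - E[X]` of a loss. -/
def center (X : Lp ℝ p μ) : Lp ℝ p μ := X - Lp.const p μ (∫ ω, X ω ∂μ)

lemma center_add_const_integral (X : Lp ℝ p μ) :
    center X + Lp.const p μ (∫ ω, X ω ∂μ) = X := sub_add_cancel _ _

lemma center_of_integral_eq_zero {X : Lp ℝ p μ} (h : ∫ ω, X ω ∂μ = 0) : center X = X := by
  simp [center, h]

lemma nonconst_center {X : Lp ℝ p μ} (hX : Nonconst X) : Nonconst (center X) := by
  rintro ⟨c, hc⟩
  refine hX ⟨c + ∫ ω, X ω ∂μ, ?_⟩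
  rw [map_add, ← hc, center_add_const_integral]

lemma center_smul (t : ℝ) (X : Lp ℝ p μ) : center (t • X) = t • center X := by
  rw [center, center, integral_smul_Lp, smul_sub]
  congr 1

variable [Fact (1 ≤ p)]

lemma integral_center (X : Lp ℝ p μ) : ∫ ω, center X ω ∂μ = 0 := by
  rw [center, integral_sub_Lp, integral_const_Lp, sub_self]

lemma center_add (X Y : Lp ℝ p μ) : center (X + Y) = center X + center Y := by
  rw [center, center, center, integral_add_Lp, map_add]
  abel

lemma center_add_const (X : Lp ℝ p μ) (c : ℝ) :
    center (X + Lp.const p μ c) = center X := by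
  rw [center, center, integral_add_Lp, integral_const_Lp, map_add]
  abel

end Center

/-! ### The deviation measure of a certainty equivalent -/

section Construction

variable {Ω : Type*} [MeasurableSpace Ω] {μ : Measure Ω} [IsProbabilityMeasure μ] {p : ℝ≥0∞}

/-- Centered losses bounded above by `1`, the ones among which the range ratio is maximized. -/
def unitLosses (p : ℝ≥0∞) (μ : Measure Ω) [IsProbabilityMeasure μ] : Set (Lp ℝ p μ) :=
  {Z | ∫ ω, Z ω ∂μ = 0 ∧ Z ≤ Lp.const p μ 1}

lemma smul_le_const_of_mem_unitLosses {Z : Lp ℝ p μ} (hZ : Z ∈ unitLosses p μ) {t : ℝ}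
    (ht : 0 ≤ t) : t • Z ≤ Lp.const p μ t := by
  rw [← Lp.coeFn_le]
  filter_upwards [(Lp.coeFn_le _ _).2 hZ.2, Lp.coeFn_const p μ (1 : ℝ), Lp.coeFn_const p μ t,
    Lp.coeFn_smul t Z] with ω h1 h2 h3 h4
  rw [h2] at h1
  rw [h3, h4]
  exact mul_le_of_le_one_right ht h1

variable [Fact (1 ≤ p)] {ρ : Lp ℝ p μ → ℝ}

/-- `D X` measures `X - E[X]` in units of a nonconstant centered loss `X₀`: the certainty
equivalent of `X - E[X]` is that of `D X • X₀`. -/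
structure IsRayDeviation (ρ : Lp ℝ p μ → ℝ) (X₀ : Lp ℝ p μ) (D : Lp ℝ p μ → ℝ≥0) : Prop where
  risk : IsCertaintyEquivalent ρ
  nonconst : Nonconst X₀
  integral_eq : ∫ ω, X₀ ω ∂μ = 0
  center_eq : ∀ X, ρ (center X) = ρ ((D X : ℝ) • X₀)

variable {X₀ : Lp ℝ p μ} {D : Lp ℝ p μ → ℝ≥0}

lemma IsCertaintyEquivalent.homog_eq (hρ : IsCertaintyEquivalent ρ) {X Y : Lp ℝ p μ}
    (hE : ∫ ω, X ω ∂μ = ∫ ω, Y ω ∂μ) (h : ρ X = ρ Y) {t : ℝ} (ht : 0 < t) :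
    ρ (t • X) = ρ (t • Y) :=
  le_antisymm (hρ.homog X Y hE h.le t ht) (hρ.homog Y X hE.symm h.ge t ht)

lemma IsRayDeviation.integral_smul (hD : IsRayDeviation ρ X₀ D) (t : ℝ) :
    ∫ ω, (t • X₀) ω ∂μ = 0 := by
  rw [integral_smul_Lp, hD.integral_eq, mul_zero]

lemma IsRayDeviation.le_iff (hD : IsRayDeviation ρ X₀ D) {X : Lp ℝ p μ} {t : ℝ≥0} :
    D X ≤ t ↔ ρ (center X) ≤ ρ ((t : ℝ) • X₀) := by
  rw [hD.center_eq, hD.risk.ray_le_iff hD.nonconst hD.integral_eq (D X).coe_nonneg t.coe_nonneg,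
    NNReal.coe_le_coe]

lemma IsRayDeviation.eq_of (hD : IsRayDeviation ρ X₀ D) {X : Lp ℝ p μ} {t : ℝ≥0}
    (h : ρ (center X) = ρ ((t : ℝ) • X₀)) : D X = t := by
  refine le_antisymm (hD.le_iff.2 h.le) ?_
  rw [← NNReal.coe_le_coe, ← hD.risk.ray_le_iff hD.nonconst hD.integral_eq t.coe_nonneg
    (D X).coe_nonneg, ← h,
    hD.center_eq]

lemma IsRayDeviation.risk_eq (hD : IsRayDeviation ρ X₀ D) (X : Lp ℝ p μ) :
    ρ X = ρ ((D X : ℝ) • X₀) + ∫ ω, X ω ∂μ := by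
  rw [← hD.center_eq, ← hD.risk.translation, center_add_const_integral]

lemma IsRayDeviation.smul (hD : IsRayDeviation ρ X₀ D) (X : Lp ℝ p μ) (t : ℝ≥0) :
    D ((t : ℝ) • X) = t * D X := by
  refine hD.eq_of ?_
  rcases eq_or_ne t 0 with rfl | ht
  · rw [NNReal.coe_zero, center_smul, zero_mul, NNReal.coe_zero, zero_smul, zero_smul]
  · rw [center_smul, NNReal.coe_mul, ← smul_smul]
    exact hD.risk.homog_eq (by rw [integral_center, hD.integral_smul]) (hD.center_eq X)
      (NNReal.coe_pos.2 (pos_iff_ne_zero.2 ht))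

lemma IsRayDeviation.pos (hD : IsRayDeviation ρ X₀ D) {X : Lp ℝ p μ} (hX : Nonconst X) :
    0 < D X := by
  rw [pos_iff_ne_zero]
  intro h
  have h1 := hD.center_eq X
  have h2 := hD.risk.integral_lt _ (nonconst_center hX)
  rw [h1, h, NNReal.coe_zero, zero_smul, hD.risk.zero, integral_center] at h2
  exact h2.false

/-- Subadditivity comes from quasiconvexity, applied to centered losses rescaled to be equivalent
to `X₀`. -/
lemma IsRayDeviation.add_le (hD : IsRayDeviation ρ X₀ D) (X Y : Lp ℝ p μ) :
    D (X + Y) ≤ D X + D Y := by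
  have hconst : ∀ X Y : Lp ℝ p μ, ¬ Nonconst X → D (X + Y) ≤ D X + D Y := by
    intro X Y hX
    obtain ⟨c, rfl⟩ := not_not.1 hX
    have : D (Lp.const p μ c + Y) = D Y := by
      refine hD.eq_of ?_
      rw [add_comm, center_add_const, hD.center_eq]
    rw [this]
    exact le_add_self
  by_cases hX : Nonconst X
  swap
  · exact hconst X Y hX
  by_cases hY : Nonconst Y
  swap
  · rw [add_comm X, add_comm (D X)]
    exact hconst Y X hY
  have ha : (0 : ℝ) < D X := hD.pos hX
  have hb : (0 : ℝ) < D Y := hD.pos hY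
  set a : ℝ := (D X : ℝ) with ha_def
  set b : ℝ := (D Y : ℝ) with hb_def
  have hunit : ∀ Z : Lp ℝ p μ, (0 : ℝ) < D Z → ρ ((D Z : ℝ)⁻¹ • center Z) = ρ X₀ := fun Z hZ => by
    have := hD.risk.homog_eq (by rw [integral_center, hD.integral_smul]) (hD.center_eq Z)
      (inv_pos.2 hZ)
    rwa [smul_smul, inv_mul_cancel₀ hZ.ne', one_smul] at this
  have hE : ∀ (t : ℝ) (Z : Lp ℝ p μ), ∫ ω, (t • center Z) ω ∂μ = 0 := fun t Z => by
    rw [integral_smul_Lp, integral_center, mul_zero]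
  have hq := hD.risk.quasiconvex (a⁻¹ • center X) (b⁻¹ • center Y) (by rw [hE, hE])
    ((hunit X ha).trans (hunit Y hb).symm) (a / (a + b)) (by positivity)
    ((div_le_one (by positivity)).2 (by linarith))
  rw [hunit X ha] at hq
  have hcomb : (a / (a + b)) • a⁻¹ • center X + (1 - a / (a + b)) • b⁻¹ • center Y =
      (a + b)⁻¹ • center (X + Y) := by
    rw [center_add, smul_add, smul_smul, smul_smul]
    congr 2 <;> field_simp
    ring
  rw [hcomb] at hq
  have h := hD.risk.homog _ _ (by rw [hE, hD.integral_eq]) hq (a + b) (by positivity)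
  rw [smul_smul, mul_inv_cancel₀ (by positivity), one_smul] at h
  rw [hD.le_iff, NNReal.coe_add]
  exact h

lemma IsRayDeviation.isDeviation (hD : IsRayDeviation ρ X₀ D) : IsDeviation D where
  translation X c := hD.eq_of (by rw [center_add_const, hD.center_eq])
  pos X hX := hD.pos hX
  posHom := hD.smul
  subadd := hD.add_le
  lawInv X Y h := by
    refine hD.eq_of ?_
    have h1 := hD.risk_eq X
    have h2 := hD.risk_eq Y
    rw [hD.risk.lawInv X Y h, h.integral_eq] at h1
    rw [hD.center_eq]
    linarith

/-- By monotonicity a small multiple of a unit loss is less risky than `X₀`, which bounds the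
deviation of unit losses. -/
lemma IsRayDeviation.bddAbove_image_unitLosses (hD : IsRayDeviation ρ X₀ D) :
    BddAbove ((fun Z => (D Z : ℝ)) '' unitLosses p μ) := by
  have hX0 : 0 < ρ X₀ := hD.integral_eq ▸ hD.risk.integral_lt X₀ hD.nonconst
  refine ⟨(ρ X₀)⁻¹, ?_⟩
  rintro _ ⟨Z, hZ, rfl⟩
  have h1 : ρ (ρ X₀ • Z) ≤ ρ X₀ := by
    refine (hD.risk.mono _ _ (smul_le_const_of_mem_unitLosses hZ hX0.le)).trans_eq ?_
    have := hD.risk.translation 0 (ρ X₀)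
    rwa [zero_add, hD.risk.zero, zero_add] at this
  have h2 : D (ρ X₀ • Z) ≤ 1 := by
    rw [hD.le_iff, NNReal.coe_one, one_smul, center_of_integral_eq_zero]
    · exact h1
    · rw [integral_smul_Lp, hZ.1, mul_zero]
  have h3 := NNReal.coe_le_coe.2 h2
  rw [hD.isDeviation.coe_smul Z hX0.le, NNReal.coe_one] at h3
  rw [← one_div, le_div_iff₀ hX0]
  linarith

/-- Dividing by the largest deviation of a unit loss gives a range-normalized deviation measure. -/
lemma IsDeviation.isRangeNormalized (hD : IsDeviation D) {K : ℝ≥0} (hK : 0 < K)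
    (hlub : IsLUB ((fun Z => (D Z : ℝ)) '' unitLosses p μ) K) :
    IsRangeNormalized fun X => D X / K where
  isDeviation :=
    { translation := fun X c => by rw [hD.translation]
      pos := fun X hX => div_pos (hD.pos X hX) hK
      posHom := fun X t => by rw [hD.posHom, mul_div_assoc]
      subadd := fun X Y => by
        rw [← add_div]
        exact div_le_div_of_nonneg_right (hD.subadd X Y) hK.le
      lawInv := fun X Y h => by rw [hD.lawInv X Y h] }
  sup_eq_one := by
    have hK' : (0 : ℝ) < K := hK
    refine le_antisymm (sSup_le ?_) (le_of_forall_lt fun b hb => ?_)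
    · rintro _ ⟨X, hX, rfl⟩
      rcases rangeRatio_cases (fun X => D X / K) X with ⟨-, h⟩ | ⟨r, -, hr, h⟩
      · rw [h]; exact zero_le_one
      · have hm : 0 < r - ∫ ω, X ω ∂μ := sub_pos.2 (hX.integral_lt hr)
        set m := r - ∫ ω, X ω ∂μ with hm_def
        have hZ : m⁻¹ • center X ∈ unitLosses p μ := by
          refine ⟨by rw [integral_smul_Lp, integral_center, mul_zero], ?_⟩
          rw [← Lp.coeFn_le]
          filter_upwards [hr, Lp.coeFn_const p μ (1 : ℝ), Lp.coeFn_smul m⁻¹ (center X),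
            Lp.coeFn_sub X (Lp.const p μ (∫ ω, X ω ∂μ)),
            Lp.coeFn_const p μ (∫ ω, X ω ∂μ)] with ω h1 h2 h3 h4 h5
          rw [h2, h3, Pi.smul_apply, center, h4, Pi.sub_apply, h5, smul_eq_mul,
            Function.const_apply, Function.const_apply, inv_mul_le_one₀ hm]
          linarith
        have hle : (D (m⁻¹ • center X) : ℝ) ≤ K := hlub.1 ⟨_, hZ, rfl⟩
        have hcen : D (center X) = D X := by
          conv_rhs => rw [← center_add_const_integral X]
          exact (hD.translation _ _).symm
        rw [hD.coe_smul _ (inv_pos.2 hm).le, hcen, inv_mul_le_iff₀ hm] at hle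
        rw [h, ← EReal.coe_one, EReal.coe_le_coe_iff, div_le_one hm, NNReal.coe_div,
          div_le_iff₀ hK']
        exact hle
    · obtain ⟨q, hbq, hq1⟩ := EReal.lt_iff_exists_real_btwn.1 hb
      rw [← EReal.coe_one, EReal.coe_lt_coe_iff] at hq1
      have hqK : max q 0 * K < K := by
        have : max q 0 < 1 := max_lt hq1 zero_lt_one
        exact mul_lt_of_lt_one_left hK' this
      obtain ⟨_, ⟨Z, hZ, rfl⟩, hlt⟩ := (lt_isLUB_iff hlub).1 hqK
      have hZpos : (0 : ℝ) < D Z := lt_of_le_of_lt (by positivity) hlt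
      have hZn : Nonconst Z := by
        rintro ⟨c, rfl⟩
        rw [hD.const] at hZpos
        exact absurd hZpos (by simp)
      have hZ1 : ∀ᵐ ω ∂μ, Z ω ≤ 1 := by
        filter_upwards [(Lp.coeFn_le _ _).2 hZ.2, Lp.coeFn_const p μ (1 : ℝ)] with ω h1 h2
        rw [h2] at h1
        exact h1
      refine hbq.trans (lt_of_lt_of_le ?_ (le_sSup ⟨Z, hZn, rfl⟩))
      have hs := (essSup_le_coe_iff Z 1).2 hZ1
      rcases rangeRatio_cases (fun X => D X / K) Z with ⟨h, -⟩ | ⟨r, hr, hrle, h⟩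
      · rw [h] at hs
        exact absurd hs (not_le.2 (EReal.coe_lt_top 1))
      · rw [hr, EReal.coe_le_coe_iff] at hs
        have hr0 : 0 < r := hZ.1 ▸ hZn.integral_lt hrle
        rw [h, EReal.coe_lt_coe_iff, hZ.1, sub_zero, NNReal.coe_div, lt_div_iff₀ hr0,
          lt_div_iff₀ hK']
        calc q * r * K ≤ max q 0 * 1 * K := by
              gcongr
              exact le_max_left _ _
          _ = max q 0 * K := by ring
          _ < D Z := hlt

/-- The risk along the ray, with the normalized deviation as parameter, is 1-Lipschitz: for a unit
loss `Z` of nearly maximal deviation, `t • Z ≤ s • Z + (t - s)`. -/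
lemma IsRayDeviation.ray_sub_le (hD : IsRayDeviation ρ X₀ D) {K : ℝ≥0} (hK : 0 < K)
    (hlub : IsLUB ((fun Z => (D Z : ℝ)) '' unitLosses p μ) K) {s t : ℝ} (hs : 0 ≤ s)
    (hst : s ≤ t) : ρ ((t * K) • X₀) - ρ ((s * K) • X₀) ≤ t - s := by
  have hK' : (0 : ℝ) < K := hK
  rcases hst.eq_or_lt with rfl | hst
  · simp
  have key : ∀ Z ∈ unitLosses p μ, (ρ ((t * K) • X₀) - ρ ((s * K) • X₀)) * D Z ≤
      (t - s) * K := by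
    intro Z hZ
    rcases (D Z).coe_nonneg.eq_or_lt with h0 | hd
    · have h0 : (D Z : ℝ) = 0 := h0.symm
      rw [h0, mul_zero]
      exact mul_nonneg (by linarith) hK'.le
    have hray : ∀ u : ℝ, 0 ≤ u → ρ ((u * K) • X₀) = ρ ((u * K / D Z) • Z) := by
      intro u hu
      rcases hu.eq_or_lt with rfl | hu
      · simp
      have h1 := hD.center_eq Z
      rw [center_of_integral_eq_zero hZ.1] at h1
      have h2 := hD.risk.homog_eq (by rw [hZ.1, hD.integral_smul]) h1
        (show 0 < u * K / D Z by positivity)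
      rw [h2, smul_smul, div_mul_cancel₀ _ hd.ne']
    have hle : (t * K / D Z) • Z ≤ (s * K / D Z) • Z + Lp.const p μ ((t - s) * K / D Z) := by
      have h1 : (t * K / D Z) • Z = (s * K / D Z) • Z + ((t - s) * K / D Z) • Z := by
        rw [← add_smul]
        congr 1
        ring
      rw [h1]
      gcongr
      exact smul_le_const_of_mem_unitLosses hZ
        (div_nonneg (mul_nonneg (by linarith) hK'.le) hd.le)
    have h3 := hD.risk.mono _ _ hle
    rw [hD.risk.translation, ← hray t (hs.trans hst.le), ← hray s hs] at h3
    rw [← le_div_iff₀ hd]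
    linarith
  by_contra! hlt
  have hpos : 0 < ρ ((t * K) • X₀) - ρ ((s * K) • X₀) := by linarith
  have hub : (K : ℝ) ≤ (t - s) * K / (ρ ((t * K) • X₀) - ρ ((s * K) • X₀)) := by
    refine hlub.2 ?_
    rintro _ ⟨Z, hZ, rfl⟩
    rw [le_div_iff₀ hpos]
    linarith [key Z hZ]
  rw [le_div_iff₀ hpos, mul_comm] at hub
  exact absurd (le_of_mul_le_mul_right hub hK') (not_le.2 hlt)

/-- A certainty equivalent obeying the axioms is a mean-deviation functional. -/
theorem IsCertaintyEquivalent.exists_representation (hμ : Nonatomic μ)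
    (hρ : IsCertaintyEquivalent ρ) :
    ∃ (D : Lp ℝ p μ → ℝ≥0) (g : ℝ≥0 → ℝ), IsRangeNormalized D ∧ IsRiskWeighting g ∧
      StrictMono g ∧ ∀ X, ρ X = MD g D X := by
  obtain ⟨X₀, hX₀, hE, hX₁⟩ := hμ.exists_nonconst p
  choose D hDc using fun X => hρ.exists_ray_eq hX₀ hE (integral_center X)
  have hD : IsRayDeviation ρ X₀ D := ⟨hρ, hX₀, hE, hDc⟩
  have hmem : X₀ ∈ unitLosses p μ := ⟨hE, hX₁⟩
  have hlub := isLUB_csSup (Set.Nonempty.image _ ⟨X₀, hmem⟩) hD.bddAbove_image_unitLosses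
  have hX₀D : (0 : ℝ) < D X₀ := hD.pos hX₀
  obtain ⟨K, hK⟩ : ∃ K : ℝ≥0, (K : ℝ) = sSup ((fun Z => (D Z : ℝ)) '' unitLosses p μ) :=
    ⟨⟨_, hX₀D.le.trans (hlub.1 ⟨X₀, hmem, rfl⟩)⟩, rfl⟩
  rw [← hK] at hlub
  have hK0 : 0 < K := NNReal.coe_pos.1 (hX₀D.trans_le (hlub.1 ⟨X₀, hmem, rfl⟩))
  let g : ℝ≥0 → ℝ := fun t => ρ (((t : ℝ) * K) • X₀)
  have hg : StrictMono g := fun s t hst => by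
    refine hρ.strictMonoOn_ray hX₀ hE (by positivity) ?_
    exact mul_lt_mul_of_pos_right (NNReal.coe_lt_coe.2 hst) hK0
  refine ⟨fun X => D X / K, g, hD.isDeviation.isRangeNormalized hK0 hlub,
    ⟨⟨0, 1, (hg zero_lt_one).ne⟩, hg.monotone, ?_, ?_⟩, hg, fun X => ?_⟩
  · refine LipschitzWith.of_le_add fun t s => ?_
    rcases le_total t s with h | h
    · exact (hg.monotone h).trans (le_add_of_nonneg_right dist_nonneg)
    · have h1 := hD.ray_sub_le hK0 hlub s.coe_nonneg (NNReal.coe_le_coe.2 h)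
      have h2 := le_abs_self ((t : ℝ) - s)
      rw [NNReal.dist_eq]
      simp only [g]
      change ρ (((t : ℝ) * K) • X₀) - ρ (((s : ℝ) * K) • X₀) ≤ (t : ℝ) - s at h1
      linarith
  · simp [g, hρ.zero]
  · have : (((D X / K : ℝ≥0) : ℝ) * K) = D X := by
      rw [NNReal.coe_div, div_mul_cancel₀]
      exact (NNReal.coe_pos.2 hK0).ne'
    rw [MD, hD.risk_eq X]
    simp only [g, this]

end Construction

end MeanDeviation

theorem theorem2 {Ω : Type*} [MeasurableSpace Ω] (μ : Measure Ω) [IsProbabilityMeasure μ]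
    (hμ : MeanDeviation.Nonatomic μ) (p : ℝ≥0∞) [Fact (1 ≤ p)]
    (R : Lp ℝ p μ → Lp ℝ p μ → Prop) (hR : MeanDeviation.IsPreference R) :
    MeanDeviation.Axioms R ↔
      ∃ (D : Lp ℝ p μ → ℝ≥0) (g : ℝ≥0 → ℝ),
        MeanDeviation.IsRangeNormalized D ∧ MeanDeviation.IsRiskWeighting g ∧ StrictMono g ∧
          MeanDeviation.Represents (MeanDeviation.MD g D) R := by
  constructor
  · intro hA
    obtain ⟨ρ, hρ, hrep⟩ := hA.exists_certaintyEquivalent hR hμ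
    obtain ⟨D, g, hD, hg, hgs, hMD⟩ := hρ.exists_representation hμ
    exact ⟨D, g, hD, hg, hgs, fun X Y => by rw [hrep, hMD, hMD]⟩
  · rintro ⟨D, g, hD, hg, hgs, hrep⟩
    exact .of_represents hμ hD hg hgs hrep

end
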